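/- Fix $N$ experts and tasks $1,\dots,T$. Task $t$ has a hidden state $Y(t)\in\{-1,1\}$ with $\mathbb P(Y(t)=1)=\mathbb P(Y(t)=-1)=\tfrac12$, and expert $i$ gives an opinion $X_i(t)\in\{-1,1\}$ on it. Given $Y(t)$ the opinions $X_1(t),\dots,X_N(t)$ are conditionally independent, and $\mathbb P(X_i(t)=Y(t)\mid Y(t)=y)=p_i$ for both $y\in\{-1,1\}$ and every task $t$, where $p\in[0,1]^N$ is arbitrary. Different tasks are independent. Let $V(\mathbf X_{\setminus i}(t))$ be the sign of $\sum_{j\ne i}X_j(t)$ (majority vote of the peers of $i$). Every sign takes values in $\{-1,1\}$, and ties are broken by arbitrary, possibly random, values in $\{-1,1\}$; those used on task $t$ are independent of $(Y(t),\mathbf X(t))$ and belong to task $t$ (so they are independent of the other tasks). Define the pseudo competence and the empirical pseudo competence after $\tau$ tasks by $$\tilde p_i=\mathbb P\big(X_i(t)=V(\mathbf X_{\setminus i}(t))\big),\qquad \tilde p_i(\tau)=\frac1\tau\sum_{s=1}^{\tau}\mathbf 1\{X_i(s)=V(\mathbf X_{\setminus i}(s))\},$$ where $\tilde p_i$ does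 not depend on $t$. With weights frozen after $\tau$ tasks, define the adaptive rule $$f^A_\tau(\mathbf x)=\operatorname{sign}\Big(\sum_{i=1}^N x_i\log\frac{\tilde p_i(\tau)}{1-\tilde p_i(\tau)}\Big),$$ where the logarithm is $-\infty$ at $\tilde p_i(\tau)=0$ and $+\infty$ at $\tilde p_i(\tau)=1$, and a sum of the form $\infty-\infty$ counts as a tie. Let $\tau\ge 1$, let $\delta\ge\sum_{i=1}^N|p_i-\tilde p_i|+\frac{N}{\sqrt\tau}$, and let $R(\tau)$ be the event $$\exp\Big(-\frac12\sum_{i=1}^N\Big(\tilde p_i(\tau)-\frac12\Big)\log\frac{\tilde p_i(\tau)}{1-\tilde p_i(\tau)}\Big)\le\frac\delta2,$$ where the sum is $+\infty$ and its exponential is $0$ if some $\tilde p_i(\tau)\in\{0,1\}$. Then for every task $t$ with $\tau<t\le T$, $$\mathbb P\big(R(\tau)\cap\{f^A_\tau(\mathbf X(t))\ne Y(t)\}\big)\le\delta .$$ -/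

import Mathlib

open MeasureTheory ProbabilityTheory

/-- The sign of an integer with values in `{-1, 1}`; the value `tie` is used at zero. -/
def signTie (s tie : ℤ) : ℤ :=
  if 0 < s then 1 else if s < 0 then -1 else tie

/-- The majority vote of all experts other than `i` on the opinions `x`, ties going to `tie`. -/
def peerVote {N : ℕ} (x : Fin N → ℤ) (i : Fin N) (tie : ℤ) : ℤ :=
  signTie (∑ j ∈ Finset.univ.erase i, x j) tie

/-- The model of stochastic experts with competences `p` on the tasks `1, …, T`.
`Y t` is the hidden state of task `t`, `X i t` the opinion of expert `i` on task `t`.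
`U i t` is the value in `{-1, 1}` given to a tie among the peers of expert `i` on task `t`, and
`C t` the value given to a tie of the aggregation rule on task `t`. The tie values are arbitrary
(constant or randomized), but they carry no information on the states and the opinions. -/
structure IsExpertModel {Ω : Type*} [MeasurableSpace Ω] (P : Measure Ω) {N : ℕ} (T : ℕ)
    (p : Fin N → ℝ) (Y : ℕ → Ω → ℤ) (X : Fin N → ℕ → Ω → ℤ)
    (U : Fin N → ℕ → Ω → ℤ) (C : ℕ → Ω → ℤ) : Prop where
  measurable_state : ∀ t ∈ Finset.Icc 1 T, Measurable (Y t)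
  measurable_opinion : ∀ i, ∀ t ∈ Finset.Icc 1 T, Measurable (X i t)
  measurable_voteTie : ∀ i, ∀ t ∈ Finset.Icc 1 T, Measurable (U i t)
  measurable_ruleTie : ∀ t ∈ Finset.Icc 1 T, Measurable (C t)
  state_mem : ∀ t ∈ Finset.Icc 1 T, ∀ ω, Y t ω = -1 ∨ Y t ω = 1
  opinion_mem : ∀ i, ∀ t ∈ Finset.Icc 1 T, ∀ ω, X i t ω = -1 ∨ X i t ω = 1
  voteTie_mem : ∀ i, ∀ t ∈ Finset.Icc 1 T, ∀ ω, U i t ω = -1 ∨ U i t ω = 1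
  ruleTie_mem : ∀ t ∈ Finset.Icc 1 T, ∀ ω, C t ω = -1 ∨ C t ω = 1
  /-- The prior of the states is uniform. -/
  uniform_prior : ∀ t ∈ Finset.Icc 1 T,
    P.real {ω | Y t ω = 1} = 1 / 2 ∧ P.real {ω | Y t ω = -1} = 1 / 2
  /-- Expert `i` identifies the state with probability `p i`, on every task and in either state. -/
  competence : ∀ i, ∀ t ∈ Finset.Icc 1 T, ∀ y : ℤ, y = -1 ∨ y = 1 →
    (P[|{ω | Y t ω = y}]).real {ω | X i t ω = Y t ω} = p i
  /-- The opinions on a task are conditionally independent given the state. -/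
  opinions_condIndep : ∀ t ∈ Finset.Icc 1 T, ∀ y : ℤ, y = -1 ∨ y = 1 →
    iIndepFun (fun i => X i t) (P[|{ω | Y t ω = y}])
  /-- The tie values of a task are independent of its state and opinions. -/
  ties_indep : ∀ t ∈ Finset.Icc 1 T,
    IndepFun (fun ω => (Y t ω, fun i => X i t ω)) (fun ω => (C t ω, fun i => U i t ω)) P
  /-- Different tasks are independent. -/
  tasks_indep : iIndepFun (fun (t : Finset.Icc 1 T) ω =>
    ((Y t ω, fun i => X i t ω), (C t ω, fun i => U i t ω))) P

/-- The pseudo competence of expert `i` (read off task `t`): the probability that the expert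
agrees with the majority vote of the other experts. -/
noncomputable def pseudoCompetence {Ω : Type*} [MeasurableSpace Ω] (P : Measure Ω) {N : ℕ}
    (X U : Fin N → ℕ → Ω → ℤ) (i : Fin N) (t : ℕ) : ℝ :=
  P.real {ω | X i t ω = peerVote (fun j => X j t ω) i (U i t ω)}

/-- The empirical pseudo competence of expert `i` after `τ` tasks: the fraction of the tasks
`1, …, τ` on which the expert agrees with the majority vote of the other experts. -/
noncomputable def empiricalPseudoCompetence {Ω : Type*} {N : ℕ}
    (X U : Fin N → ℕ → Ω → ℤ) (τ : ℕ) (ω : Ω) (i : Fin N) : ℝ :=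
  (∑ s ∈ Finset.Icc 1 τ,
    if X i s ω = peerVote (fun j => X j s ω) i (U i s ω) then (1 : ℝ) else 0) / τ

/-- The weight `log (q / (1 - q))` of a competence `q ∈ [0, 1]`, equal to `-∞` at `q = 0` and to
`+∞` at `q = 1`. -/
noncomputable def naiveBayesWeight (q : ℝ) : EReal :=
  ENNReal.log (ENNReal.ofReal q / ENNReal.ofReal (1 - q))

/-- The committee potential `∑ i, (q i - 1/2) log (q i / (1 - q i))`, with values in `[0, ∞]`. -/
noncomputable def committeePotential {N : ℕ} (q : Fin N → ℝ) : EReal :=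
  ∑ i, ((q i - 1 / 2 : ℝ) : EReal) * naiveBayesWeight (q i)

/-- The weighted vote `sign (∑ i, x i * w i)`. The sums of the positive and of the negative parts
of the terms are compared; they can be infinite, and the value `tie` is used when they are equal
(which includes the undefined case `∞ - ∞`). -/
noncomputable def weightedVote {N : ℕ} (w : Fin N → EReal) (x : Fin N → ℤ) (tie : ℤ) : ℤ :=
  if ∑ i, (-(((x i : ℝ) : EReal) * w i)).toENNReal < ∑ i, (((x i : ℝ) : EReal) * w i).toENNReal
  then 1
  else if ∑ i, (((x i : ℝ) : EReal) * w i).toENNReal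
    < ∑ i, (-(((x i : ℝ) : EReal) * w i)).toENNReal
  then -1
  else tie

/-- The adaptive rule with its weights frozen after `τ` tasks, on the opinions `x`. -/
noncomputable def adaptiveRule {Ω : Type*} {N : ℕ} (X U : Fin N → ℕ → Ω → ℤ) (τ : ℕ) (ω : Ω)
    (x : Fin N → ℤ) (tie : ℤ) : ℤ :=
  weightedVote (fun i => naiveBayesWeight (empiricalPseudoCompetence X U τ ω i)) x tie

/-- The event `R(τ)`: `exp (-Φ/2) ≤ δ/2` for the empirical pseudo committee potential `Φ` after
`τ` tasks, where `exp (-∞) = 0`. -/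
noncomputable def confidenceEvent {Ω : Type*} {N : ℕ} (X U : Fin N → ℕ → Ω → ℤ) (τ : ℕ)
    (δ : ℝ) : Set Ω :=
  {ω | EReal.exp (((-(1 / 2) : ℝ) : EReal) *
      committeePotential (empiricalPseudoCompetence X U τ ω)) ≤ ENNReal.ofReal (δ / 2)}

/-!
Put `m i = p i - 1 / 2`. Given the state, the signs telling which experts are right are independent
with means `2 * m i`, and the pseudo competence of expert `i` is `1 / 2 + 2 * m i * g i`, where
`g i` is half the expected majority sign of the peers of `i`. Hence its distance to `p i` is the
defect `d i = |m i| * (1 - 2 * g i)`.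

The weights depend on the first `τ` tasks only, so by independence and Fubini it suffices to bound
the error of the vote whose weights come from fixed estimates `q`. The bound is `δ / 4`, plus three
quarters of the defects, plus a cost for the deviations of `q` from the pseudo competences; the
estimates have standard deviation at most `1 / (2 * √τ)`, so the mean cost per expert is at most
`3 / (4 * √τ)`.

For fixed `q` the error is affine in each `m i`, with a slope whose sign is opposite to that of the
weight. Most experts can therefore be switched, one at a time, from the bias `m i` to the ideal bias
`q i - 1 / 2` at a price that their own defect and deviation cover. The exceptions are the experts
whose weight has the wrong sign although `q i` is close to their pseudo competence. They are left
in place, and pairing a sign vector with its negative bounds the remaining error by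
`exp (-Φ / 2) / 2` times a correction factor. The inequality `|m j| - 2 * g j ≤ ∑ k, d k`, which is
piecewise affine in each `m i` and hence only has to be checked at `m i ∈ {0, ± 1 / 2}`, keeps the
exceptional estimates away from `0` and `1` and the correction factor close to one. It fails for two
experts; these are each other's only peer, so they have equal weights and each influences the error
by at most one half.
-/

section SignVectors

variable {ι : Type*}

/-- The real value `± 1` of a sign; opinions are modelled by the two-element type `ℤˣ`. -/
def signVal (u : ℤˣ) : ℝ := ((u : ℤ) : ℝ)

@[simp] lemma signVal_one : signVal 1 = 1 := by simp [signVal]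

@[simp] lemma signVal_neg (u : ℤˣ) : signVal (-u) = -signVal u := by simp [signVal]

@[simp] lemma signVal_mul (u v : ℤˣ) : signVal (u * v) = signVal u * signVal v := by
  simp [signVal]

lemma signVal_eq_one_or (u : ℤˣ) : signVal u = 1 ∨ signVal u = -1 := by
  rcases Int.units_eq_one_or u with rfl | rfl <;> simp

lemma half_add_mul_signVal_nonneg {a : ℝ} (h : |a| ≤ 1 / 2) (u : ℤˣ) :
    0 ≤ 1 / 2 + a * signVal u := by
  have := abs_le.1 h
  rcases signVal_eq_one_or u with h | h <;> rw [h] <;> linarith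

/-- The sign vector `x` with the coordinate `k` reversed. -/
def flipAt [DecidableEq ι] (k : ι) (x : ι → ℤˣ) : ι → ℤˣ := Function.update x k (-x k)

section Flip

variable [DecidableEq ι]

lemma flipAt_flipAt (k : ι) (x : ι → ℤˣ) : flipAt k (flipAt k x) = x := by
  simp [flipAt]

@[simp] lemma flipAt_same (k : ι) (x : ι → ℤˣ) : flipAt k x k = -x k := by simp [flipAt]

lemma flipAt_of_ne {k i : ι} (h : i ≠ k) (x : ι → ℤˣ) : flipAt k x i = x i := by
  simp [flipAt, h]

end Flip

variable [Fintype ι]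

/-- The probability of the sign vector `x` if its coordinates are independent with means `2 m i`:
the parameter `m i` is the probability of a positive sign minus `1 / 2`. -/
noncomputable def signMass (m : ι → ℝ) (x : ι → ℤˣ) : ℝ := ∏ i, (1 / 2 + m i * signVal (x i))

lemma signMass_nonneg {m : ι → ℝ} (hm : ∀ i, |m i| ≤ 1 / 2) (x : ι → ℤˣ) : 0 ≤ signMass m x :=
  Finset.prod_nonneg fun i _ => half_add_mul_signVal_nonneg (hm i) _

variable [DecidableEq ι]

lemma sum_prod_sign (f : ι → ℤˣ → ℝ) :
    ∑ x : ι → ℤˣ, ∏ i, f i (x i) = ∏ i, (f i 1 + f i (-1)) := by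
  have sum_sign (g : ℤˣ → ℝ) : ∑ u, g u = g 1 + g (-1) := by
    rw [UnitsInt.univ, Finset.sum_pair (by decide)]
  simp_rw [← sum_sign]
  rw [Finset.prod_univ_sum, Fintype.piFinset_univ]

lemma sum_flipAt (k : ι) (f : (ι → ℤˣ) → ℝ) : ∑ x, f (flipAt k x) = ∑ x, f x :=
  Fintype.sum_bijective _ (Function.Involutive.bijective (flipAt_flipAt k)) _ _ fun _ => rfl

lemma sum_mul_left_sign (s : ι → ℤˣ) (f : (ι → ℤˣ) → ℝ) : ∑ x, f (s * x) = ∑ x, f x :=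
  Fintype.sum_bijective _ (Group.mulLeft_bijective s) _ _ fun _ => rfl

lemma sum_signMass (m : ι → ℝ) : ∑ x, signMass m x = 1 := by
  unfold signMass
  rw [sum_prod_sign fun i u => 1 / 2 + m i * signVal u]
  refine Finset.prod_eq_one fun i _ => ?_
  rw [signVal_neg, signVal_one]
  ring

/-- The expectation of `F` on sign vectors with independent coordinates of means `2 m i`. -/
noncomputable def signMean (m : ι → ℝ) (F : (ι → ℤˣ) → ℝ) : ℝ := ∑ x, signMass m x * F x

lemma signMean_const (m : ι → ℝ) (c : ℝ) : signMean m (fun _ => c) = c := by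
  rw [signMean, ← Finset.sum_mul, sum_signMass, one_mul]

lemma signMean_add (m : ι → ℝ) (F G : (ι → ℤˣ) → ℝ) :
    signMean m (fun x => F x + G x) = signMean m F + signMean m G := by
  simp only [signMean, mul_add, Finset.sum_add_distrib]

lemma signMean_const_mul (m : ι → ℝ) (c : ℝ) (F : (ι → ℤˣ) → ℝ) :
    signMean m (fun x => c * F x) = c * signMean m F := by
  simp only [signMean, Finset.mul_sum, mul_left_comm]

lemma signMean_mono {m : ι → ℝ} (hm : ∀ i, |m i| ≤ 1 / 2) {F G : (ι → ℤˣ) → ℝ}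
    (h : ∀ x, signMass m x ≠ 0 → F x ≤ G x) : signMean m F ≤ signMean m G := by
  refine Finset.sum_le_sum fun x _ => ?_
  by_cases hx : signMass m x = 0
  · rw [hx, zero_mul, zero_mul]
  · exact mul_le_mul_of_nonneg_left (h x hx) (signMass_nonneg hm x)

lemma signMean_mul_left (m : ι → ℝ) (r : ι → ℤˣ) (F : (ι → ℤˣ) → ℝ) :
    signMean m (fun x => F (r * x)) = signMean (fun i => signVal (r i) * m i) F := by
  rw [signMean, signMean, ← sum_mul_left_sign r fun x => signMass _ x * F x]
  refine Finset.sum_congr rfl fun x _ => ?_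
  congr 1
  refine Finset.prod_congr rfl fun i _ => ?_
  rcases signVal_eq_one_or (r i) with h | h <;> simp [h]

/-- The factor of `signMass` that comes from the coordinates other than `k`; as a weight on all
sign vectors it has total mass `2`. -/
noncomputable def restMass (m : ι → ℝ) (k : ι) (x : ι → ℤˣ) : ℝ :=
  ∏ i ∈ Finset.univ.erase k, (1 / 2 + m i * signVal (x i))

lemma restMass_nonneg {m : ι → ℝ} (k : ι) (hm : ∀ i, |m i| ≤ 1 / 2) (x : ι → ℤˣ) :
    0 ≤ restMass m k x :=
  Finset.prod_nonneg fun i _ => half_add_mul_signVal_nonneg (hm i) _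

lemma signMass_eq_mul_restMass (m : ι → ℝ) (k : ι) (x : ι → ℤˣ) :
    signMass m x = (1 / 2 + m k * signVal (x k)) * restMass m k x :=
  (Finset.mul_prod_erase _ _ (Finset.mem_univ k)).symm

lemma restMass_flipAt (m : ι → ℝ) (k : ι) (x : ι → ℤˣ) :
    restMass m k (flipAt k x) = restMass m k x :=
  Finset.prod_congr rfl fun i hi => by rw [flipAt_of_ne (Finset.ne_of_mem_erase hi)]

lemma restMass_update (m : ι → ℝ) (k : ι) (a : ℝ) (x : ι → ℤˣ) :
    restMass (Function.update m k a) k x = restMass m k x :=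
  Finset.prod_congr rfl fun i hi => by
    rw [Function.update_of_ne (Finset.ne_of_mem_erase hi)]

lemma signMean_eq_restMass (m : ι → ℝ) (k : ι) (F : (ι → ℤˣ) → ℝ) :
    signMean m F = (1 / 2) * ∑ x, restMass m k x * F x
      + m k * ∑ x, restMass m k x * (signVal (x k) * F x) := by
  unfold signMean
  rw [Finset.mul_sum, Finset.mul_sum, ← Finset.sum_add_distrib]
  refine Finset.sum_congr rfl fun x _ => ?_
  rw [signMass_eq_mul_restMass m k]
  ring

lemma signMean_update (m : ι → ℝ) (k : ι) (a : ℝ) (F : (ι → ℤˣ) → ℝ) :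
    signMean (Function.update m k a) F = (1 / 2) * ∑ x, restMass m k x * F x
      + a * ∑ x, restMass m k x * (signVal (x k) * F x) := by
  rw [signMean_eq_restMass _ k]
  simp only [restMass_update, Function.update_self]

lemma sum_restMass (m : ι → ℝ) (k : ι) : ∑ x, restMass m k x = 2 := by
  have h := signMean_update m k 0 fun _ => 1
  simp only [signMean_const, mul_one, zero_mul, add_zero] at h
  linarith

lemma sum_restMass_mul_signVal (m : ι → ℝ) (k : ι) (F : (ι → ℤˣ) → ℝ) :
    ∑ x, restMass m k x * (signVal (x k) * F x)
      = (1 / 2) * ∑ x, restMass m k x * (signVal (x k) * (F x - F (flipAt k x))) := by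
  have hflip := sum_flipAt k fun x => restMass m k x * (signVal (x k) * F x)
  simp only [restMass_flipAt, flipAt_same, signVal_neg, neg_mul, mul_neg,
    Finset.sum_neg_distrib] at hflip
  simp only [mul_sub, Finset.sum_sub_distrib, ← hflip]
  ring

lemma signMean_update_of_flipAt {k : ι} {F : (ι → ℤˣ) → ℝ} (hF : ∀ x, F (flipAt k x) = F x)
    (m : ι → ℝ) (a : ℝ) : signMean (Function.update m k a) F = signMean m F := by
  rw [signMean_update, signMean_eq_restMass m k, sum_restMass_mul_signVal]
  simp [hF]

lemma signMean_signVal_mul {k : ι} {F : (ι → ℤˣ) → ℝ} (hF : ∀ x, F (flipAt k x) = F x)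
    (m : ι → ℝ) : signMean m (fun x => signVal (x k) * F x) = 2 * m k * signMean m F := by
  have hsq (x : ι → ℤˣ) : signVal (x k) * (signVal (x k) * F x) = F x := by
    rcases signVal_eq_one_or (x k) with h | h <;> rw [h] <;> ring
  rw [signMean_eq_restMass m k, signMean_eq_restMass m k F, sum_restMass_mul_signVal m k F]
  simp only [hsq, hF, sub_self, mul_zero, Finset.sum_const_zero]
  ring

/-- The slope `β` is a mean of influences of the coordinate `k`. -/
lemma exists_signMean_eq_update_add {m : ι → ℝ} (k : ι) (hm : ∀ i, |m i| ≤ 1 / 2) (a : ℝ)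
    {F : (ι → ℤˣ) → ℝ} {lo hi : ℝ}
    (hF : ∀ x, signVal (x k) * (F x - F (flipAt k x)) ∈ Set.Icc lo hi) :
    ∃ β ∈ Set.Icc lo hi,
      signMean m F = signMean (Function.update m k a) F + (m k - a) * β := by
  have hlo : ∑ x, restMass m k x * lo
      ≤ ∑ x, restMass m k x * (signVal (x k) * (F x - F (flipAt k x))) :=
    Finset.sum_le_sum fun x _ => mul_le_mul_of_nonneg_left (hF x).1 (restMass_nonneg k hm x)
  have hhi : ∑ x, restMass m k x * (signVal (x k) * (F x - F (flipAt k x)))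
      ≤ ∑ x, restMass m k x * hi :=
    Finset.sum_le_sum fun x _ => mul_le_mul_of_nonneg_left (hF x).2 (restMass_nonneg k hm x)
  rw [← Finset.sum_mul, sum_restMass] at hlo hhi
  refine ⟨∑ x, restMass m k x * (signVal (x k) * F x), ?_, ?_⟩
  · rw [sum_restMass_mul_signVal]
    constructor <;> linarith
  · rw [signMean_eq_restMass m k, signMean_update]
    ring

end SignVectors

section PeerMajority

variable {ι : Type*} [Fintype ι] [DecidableEq ι]

/-- The sum of the signs other than the one of `k`. -/
def peerSum (k : ι) (x : ι → ℤˣ) : ℤ := ∑ i ∈ Finset.univ.erase k, (x i : ℤ)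

/-- The majority sign of the coordinates other than `k`, zero for a tie: the mean of the peer vote
over a fair tie value. -/
noncomputable def peerSign (k : ι) (x : ι → ℤˣ) : ℝ := (SignType.sign (peerSum k x) : ℝ)

/-- Half the expected majority sign of the coordinates other than `k`. -/
noncomputable def peerBias (m : ι → ℝ) (k : ι) : ℝ := signMean m (peerSign k) / 2

lemma signType_coe_mem_Icc (s : SignType) : (s : ℝ) ∈ Set.Icc (-1 : ℝ) 1 := by
  cases s <;> simp

lemma peerSign_flipAt (k : ι) (x : ι → ℤˣ) : peerSign k (flipAt k x) = peerSign k x := by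
  rw [peerSign, peerSign, peerSum, peerSum]
  congr 2
  exact Finset.sum_congr rfl fun i hi => by rw [flipAt_of_ne (Finset.ne_of_mem_erase hi)]

lemma abs_peerBias_le {m : ι → ℝ} (hm : ∀ i, |m i| ≤ 1 / 2) (k : ι) : |peerBias m k| ≤ 1 / 2 := by
  have hlower := signMean_mono hm fun x _ => (signType_coe_mem_Icc (SignType.sign (peerSum k x))).1
  have hupper := signMean_mono hm fun x _ => (signType_coe_mem_Icc (SignType.sign (peerSum k x))).2
  rw [signMean_const] at hlower hupper
  rw [abs_le, peerBias]
  unfold peerSign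
  constructor <;> linarith

lemma peerBias_neg (m : ι → ℝ) (k : ι) : peerBias (-m) k = -peerBias m k := by
  have hmean : signMean (-m) (peerSign k) = signMean m (fun x => peerSign k (-1 * x)) := by
    rw [signMean_mul_left]
    congr 1
    ext i
    simp
  have hsign (x : ι → ℤˣ) : peerSign k (-1 * x) = -peerSign k x := by
    simp only [peerSign, peerSum, neg_one_mul, Pi.neg_apply, Units.val_neg,
      Finset.sum_neg_distrib, Left.sign_neg, SignType.coe_neg]
  rw [peerBias, hmean, peerBias, ← neg_div, signMean, signMean, ← Finset.sum_neg_distrib]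
  simp only [hsign, mul_neg]

lemma peerBias_update_self (m : ι → ℝ) (k : ι) (a : ℝ) :
    peerBias (Function.update m k a) k = peerBias m k := by
  unfold peerBias
  rw [signMean_update_of_flipAt (peerSign_flipAt k)]

lemma exists_peerBias_update_eq (m : ι → ℝ) (i k : ι) :
    ∃ u v : ℝ, ∀ a, peerBias (Function.update m i a) k = u + v * a :=
  ⟨(1 / 2) * (∑ x, restMass m i x * peerSign k x) / 2,
    (∑ x, restMass m i x * (signVal (x i) * peerSign k x)) / 2, fun a => by
      rw [peerBias, signMean_update]
      ring⟩

end PeerMajority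

section Vertices

variable {ι : Type*}

/-- The parameters of sign vectors whose coordinates are fair (`s i = 0`) or deterministic with
value `s i`. These are the extreme points on which inequalities for the bias are checked. -/
noncomputable def vertexBias (s : ι → SignType) (i : ι) : ℝ := (s i : ℝ) / 2

lemma abs_vertexBias_le (s : ι → SignType) (i : ι) : |vertexBias s i| ≤ 1 / 2 := by
  unfold vertexBias
  cases s i <;> norm_num [abs_le]

lemma abs_vertexBias_eq {s : ι → SignType} {i : ι} (hi : s i ≠ 0) : |vertexBias s i| = 1 / 2 := by
  unfold vertexBias
  cases h : s i
  · exact absurd h hi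
  all_goals norm_num

lemma vertexBias_eq_zero {s : ι → SignType} {i : ι} (hi : s i = 0) : vertexBias s i = 0 := by
  simp [vertexBias, hi]

lemma vertexBias_neg (s : ι → SignType) : vertexBias (-s) = -vertexBias s := by
  ext i
  simp [vertexBias, neg_div]

variable [Fintype ι]

lemma coe_eq_of_signMass_vertexBias_ne_zero {s : ι → SignType} {x : ι → ℤˣ}
    (hx : signMass (vertexBias s) x ≠ 0) {i : ι} (hi : s i ≠ 0) : (x i : ℤ) = s i := by
  have hfactor := Finset.prod_ne_zero_iff.1 hx i (Finset.mem_univ i)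
  unfold vertexBias at hfactor
  rcases Int.units_eq_one_or (x i) with h | h <;> rw [h] at hfactor ⊢ <;> cases hs : s i <;>
    first | exact absurd hs hi | rfl | norm_num [hs] at hfactor

variable [DecidableEq ι]

/-- The lead of the positive over the negative deterministic coordinates other than `k`. -/
def peerLead (s : ι → SignType) (k : ι) : ℤ := ∑ i ∈ Finset.univ.erase k, (s i : ℤ)

lemma peerLead_neg (s : ι → SignType) (k : ι) : peerLead (-s) k = -peerLead s k := by
  simp [peerLead]

/-- Reversing the fair coordinates preserves the law, and the two peer sums add up to twice the
deterministic lead. -/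
lemma peerBias_vertexBias_nonpos {s : ι → SignType} {k : ι} (h : peerLead s k ≤ 0) :
    peerBias (vertexBias s) k ≤ 0 := by
  set r : ι → ℤˣ := fun i => if s i = 0 then -1 else 1 with hr
  have hlaw : (fun i => signVal (r i) * vertexBias s i) = vertexBias s := by
    ext i
    by_cases h0 : s i = 0 <;> simp [hr, h0, vertexBias]
  have hsum (x : ι → ℤˣ) (hx : signMass (vertexBias s) x ≠ 0) :
      peerSum k x + peerSum k (r * x) = 2 * peerLead s k := by
    unfold peerSum peerLead
    rw [← Finset.sum_add_distrib, Finset.mul_sum]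
    refine Finset.sum_congr rfl fun i _ => ?_
    by_cases h0 : s i = 0
    · simp [hr, h0]
    · simp [hr, h0, coe_eq_of_signMass_vertexBias_ne_zero hx h0, two_mul]
  have hmean : signMean (vertexBias s) (fun x => peerSign k x + peerSign k (r * x)) ≤ 0 := by
    rw [← signMean_const (vertexBias s) 0]
    refine signMean_mono (abs_vertexBias_le s) fun x hx => ?_
    have hle : SignType.sign (peerSum k x) ≤ -SignType.sign (peerSum k (r * x)) := by
      rw [← Left.sign_neg]
      exact SignType.sign.monotone (by have := hsum x hx; omega)
    unfold peerSign
    revert hle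
    generalize SignType.sign (peerSum k x) = a
    generalize SignType.sign (peerSum k (r * x)) = b
    cases a <;> cases b <;> simp
  rw [signMean_add, signMean_mul_left, hlaw] at hmean
  unfold peerBias
  linarith

lemma peerBias_vertexBias_nonneg {s : ι → SignType} {k : ι} (h : 0 ≤ peerLead s k) :
    0 ≤ peerBias (vertexBias s) k := by
  have := peerBias_vertexBias_nonpos (s := -s) (k := k) (by rw [peerLead_neg]; omega)
  rw [vertexBias_neg, peerBias_neg] at this
  linarith

/-- The fair peer `l` halves the lean that a deterministic lead of one can produce. -/
lemma peerBias_vertexBias_le_quarter {s : ι → SignType} {k l : ι} (hlk : l ≠ k) (hl : s l = 0)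
    (h : peerLead s k ≤ 1) : peerBias (vertexBias s) k ≤ 1 / 4 := by
  have hvertex (σ : SignType) :
      vertexBias (Function.update s l σ) = Function.update (vertexBias s) l ((σ : ℝ) / 2) := by
    ext i
    by_cases hi : i = l
    · subst hi
      simp [vertexBias]
    · simp [vertexBias, hi]
  have hneg : peerBias (vertexBias (Function.update s l (-1))) k ≤ 0 := by
    refine peerBias_vertexBias_nonpos ?_
    have hmem : l ∈ Finset.univ.erase k := Finset.mem_erase.2 ⟨hlk, Finset.mem_univ l⟩
    unfold peerLead at h ⊢
    rw [← Finset.add_sum_erase _ _ hmem] at h ⊢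
    rw [Finset.sum_congr rfl fun i hi => by
      rw [Function.update_of_ne (Finset.ne_of_mem_erase hi)]]
    simp only [hl, Function.update_self, SignType.coe_zero, SignType.coe_neg,
      SignType.coe_one] at h ⊢
    omega
  have hpos : peerBias (vertexBias (Function.update s l 1)) k ≤ 1 / 2 :=
    (le_abs_self _).trans (abs_peerBias_le (abs_vertexBias_le _) k)
  have hfair : vertexBias (Function.update s l 0) = vertexBias s := by
    rw [← hl, Function.update_eq_self]
  obtain ⟨u, v, huv⟩ := exists_peerBias_update_eq (vertexBias s) l k
  rw [hvertex, huv] at hneg hpos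
  rw [← hfair, hvertex, huv]
  simp only [SignType.coe_neg, SignType.coe_one, SignType.coe_zero] at *
  linarith

lemma neg_quarter_le_peerBias_vertexBias {s : ι → SignType} {k l : ι} (hlk : l ≠ k)
    (hl : s l = 0) (h : -1 ≤ peerLead s k) : -(1 / 4) ≤ peerBias (vertexBias s) k := by
  have := peerBias_vertexBias_le_quarter (s := -s) hlk (by simp [hl])
    (by rw [peerLead_neg]; omega : peerLead (-s) k ≤ 1)
  rw [vertexBias_neg, peerBias_neg] at this
  linarith

end Vertices

section VertexReduction

variable {ι : Type*} [DecidableEq ι]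

/-- A function that is affine in each coordinate on `[-1/2, 0]` and on `[0, 1/2]` is minimal at a
vertex. -/
lemma nonneg_of_vertexBias_nonneg [Finite ι] {Φ : (ι → ℝ) → ℝ}
    (hΦ : ∀ m i, ∃ α β γ : ℝ, ∀ a, Φ (Function.update m i a) = α + β * a + γ * |a|)
    (hvertex : ∀ s, 0 ≤ Φ (vertexBias s)) {m : ι → ℝ} (hm : ∀ i, |m i| ≤ 1 / 2) : 0 ≤ Φ m := by
  have := Fintype.ofFinite ι
  suffices h : ∀ (S : Finset ι) (m : ι → ℝ), (∀ i, |m i| ≤ 1 / 2) →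
      (∀ i ∉ S, ∃ σ : SignType, m i = (σ : ℝ) / 2) → 0 ≤ Φ m from
    h Finset.univ m hm fun i hi => absurd (Finset.mem_univ i) hi
  intro S
  induction S using Finset.induction_on with
  | empty =>
    intro m _ h
    choose s hs using fun i => h i (Finset.notMem_empty i)
    exact funext hs ▸ hvertex s
  | insert i S _ ih =>
    intro m hm h
    obtain ⟨α, β, γ, hαβγ⟩ := hΦ m i
    have hend (σ : SignType) : 0 ≤ α + β * ((σ : ℝ) / 2) + γ * |(σ : ℝ) / 2| := by
      rw [← hαβγ]
      refine ih _ (fun k => ?_) fun k hk => ?_ <;> rcases eq_or_ne k i with rfl | hki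
      · rw [Function.update_self]
        exact abs_vertexBias_le (fun _ => σ) k
      · rw [Function.update_of_ne hki]
        exact hm k
      · exact ⟨σ, Function.update_self _ _ _⟩
      · rw [Function.update_of_ne hki]
        exact h k (by simp [hki, hk])
    have hzero := hend 0
    have hpos := hend 1
    have hneg := hend (-1)
    norm_num [abs_of_neg, abs_of_pos] at hzero hpos hneg
    rw [← Function.update_eq_self i m, hαβγ]
    have hmi := hm i
    rcases le_total 0 (m i) with hi | hi
    · rw [abs_of_nonneg hi] at hmi ⊢
      nlinarith
    · rw [abs_of_nonpos hi] at hmi ⊢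
      nlinarith

lemma exists_abs_update_eq (m : ι → ℝ) (i k : ι) :
    ∃ α γ : ℝ, ∀ a, |Function.update m i a k| = α + γ * |a| := by
  rcases eq_or_ne k i with rfl | hki
  · exact ⟨0, 1, fun a => by rw [Function.update_self]; ring⟩
  · exact ⟨|m k|, 0, fun a => by rw [Function.update_of_ne hki]; ring⟩

end VertexReduction

section Defect

variable {ι : Type*} [Fintype ι] [DecidableEq ι]

/-- The distance between the competence `1 / 2 + m k` and the pseudo competence
`1 / 2 + 2 * m k * peerBias m k` of `k`. -/
noncomputable def competenceDefect (m : ι → ℝ) (k : ι) : ℝ := |m k| * (1 - 2 * peerBias m k)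

lemma competenceDefect_nonneg {m : ι → ℝ} (hm : ∀ i, |m i| ≤ 1 / 2) (k : ι) :
    0 ≤ competenceDefect m k :=
  mul_nonneg (abs_nonneg _) (by linarith [(abs_le.1 (abs_peerBias_le hm k)).2])

lemma half_le_competenceDefect_vertexBias {s : ι → SignType} {k : ι} (hk : s k ≠ 0)
    (h : peerLead s k ≤ 0) : 1 / 2 ≤ competenceDefect (vertexBias s) k := by
  rw [competenceDefect, abs_vertexBias_eq hk]
  linarith [peerBias_vertexBias_nonpos h]

lemma quarter_le_competenceDefect_vertexBias {s : ι → SignType} {k l : ι} (hk : s k ≠ 0)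
    (hlk : l ≠ k) (hl : s l = 0) (h : peerLead s k ≤ 1) :
    1 / 4 ≤ competenceDefect (vertexBias s) k := by
  rw [competenceDefect, abs_vertexBias_eq hk]
  linarith [peerBias_vertexBias_le_quarter hlk hl h]

lemma peerLead_add (s : ι → SignType) (k : ι) : peerLead s k + (s k : ℤ) = ∑ i, (s i : ℤ) :=
  Finset.sum_erase_add _ _ (Finset.mem_univ k)

lemma exists_eq_neg_one_of_peerLead_neg {s : ι → SignType} {j : ι} (h : peerLead s j < 0) :
    ∃ k, k ≠ j ∧ s k = -1 := by
  obtain ⟨k, hk, hneg⟩ := Finset.exists_lt_of_sum_lt (g := fun _ => (0 : ℤ))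
    (h.trans_eq Finset.sum_const_zero.symm)
  refine ⟨k, Finset.ne_of_mem_erase hk, ?_⟩
  cases hs : s k <;> simp_all

lemma exists_ne_ne_of_three_le_card {κ : Type*} [Fintype κ] (hcard : 3 ≤ Fintype.card κ)
    (j k : κ) : ∃ l, l ≠ j ∧ l ≠ k := by
  classical
  obtain ⟨l, -, hl⟩ := Finset.exists_mem_notMem_of_card_lt_card (s := {j, k}) (t := Finset.univ)
    (Finset.card_le_two.trans_lt (by rwa [Finset.card_univ]))
  rw [Finset.mem_insert, Finset.mem_singleton, not_or] at hl
  exact ⟨l, hl⟩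

lemma competenceDefect_le_sum_erase {m : ι → ℝ} (hm : ∀ i, |m i| ≤ 1 / 2) {j k : ι}
    (hkj : k ≠ j) : competenceDefect m k ≤ ∑ i ∈ Finset.univ.erase j, competenceDefect m i :=
  Finset.single_le_sum (fun i _ => competenceDefect_nonneg hm i)
    (Finset.mem_erase.2 ⟨hkj, Finset.mem_univ k⟩)

lemma neg_peerBias_vertexBias_le_sum_erase (hcard : 3 ≤ Fintype.card ι) {s : ι → SignType} {j : ι}
    (hlead : peerLead s j < 0) :
    -peerBias (vertexBias s) j
      ≤ ∑ k ∈ Finset.univ.erase j, competenceDefect (vertexBias s) k := by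
  have hle_sum {k : ι} (hkj : k ≠ j) := competenceDefect_le_sum_erase (abs_vertexBias_le s) hkj
  by_cases hex : ∃ i, i ≠ j ∧ s i ≠ 0 ∧ peerLead s i ≤ 0
  · obtain ⟨i, hij, hi, hlead_i⟩ := hex
    have hgj := (abs_le.1 (abs_peerBias_le (abs_vertexBias_le s) j)).1
    linarith [hle_sum hij, half_le_competenceDefect_vertexBias hi hlead_i]
  push Not at hex
  obtain ⟨k, hkj, hk⟩ := exists_eq_neg_one_of_peerLead_neg hlead
  have htotal_j := peerLead_add s j
  have htotal_k := peerLead_add s k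
  have hlead_k := hex k hkj (by simp [hk])
  have hk_coe : (s k : ℤ) = -1 := by rw [hk]; rfl
  have hj_le : (s j : ℤ) ≤ 1 := by cases s j <;> decide
  have hnonpos (i : ι) (hij : i ≠ j) : (s i : ℤ) ≤ 0 := by
    by_contra! hpos
    have htotal_i := peerLead_add s i
    have hlead_i := hex i hij fun h => by simp [h] at hpos
    omega
  obtain ⟨l, hlj, hlk⟩ := exists_ne_ne_of_three_le_card hcard j k
  have hl : s l = 0 := by
    have hmem : k ∈ Finset.univ.erase j := Finset.mem_erase.2 ⟨hkj, Finset.mem_univ k⟩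
    have hrest : ∑ i ∈ (Finset.univ.erase j).erase k, (s i : ℤ) = 0 := by
      have := Finset.add_sum_erase _ (fun i => (s i : ℤ)) hmem
      rw [peerLead] at htotal_j hlead
      omega
    rw [Finset.sum_eq_zero_iff_of_nonpos fun i hi =>
      hnonpos i (Finset.ne_of_mem_erase (Finset.mem_of_mem_erase hi))] at hrest
    have := hrest l (by simp [hlj, hlk])
    cases hs : s l <;> simp_all
  have hgj := neg_quarter_le_peerBias_vertexBias hlj hl (by omega : -1 ≤ peerLead s j)
  have hdefect_k := quarter_le_competenceDefect_vertexBias (by simp [hk]) hlk hl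
    (by omega : peerLead s k ≤ 1)
  linarith [hle_sum hkj]

lemma neg_two_mul_peerBias_vertexBias_le_sum_erase (hcard : 3 ≤ Fintype.card ι)
    {s : ι → SignType} {j : ι} (hj : s j = 0) (hlead : peerLead s j < 0) :
    -2 * peerBias (vertexBias s) j
      ≤ ∑ k ∈ Finset.univ.erase j, competenceDefect (vertexBias s) k := by
  have hj_coe : (s j : ℤ) = 0 := by rw [hj]; rfl
  have htotal_j := peerLead_add s j
  have hdefect {i : ι} (hi : s i ≠ 0) : 1 / 2 ≤ competenceDefect (vertexBias s) i := by
    refine half_le_competenceDefect_vertexBias hi ?_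
    have htotal_i := peerLead_add s i
    have hneg : -1 ≤ (s i : ℤ) := by cases s i <;> decide
    omega
  obtain ⟨k, hkj, hk⟩ := exists_eq_neg_one_of_peerLead_neg hlead
  have hk_coe : (s k : ℤ) = -1 := by rw [hk]; rfl
  have hdefect_k := hdefect (by simp [hk] : s k ≠ 0)
  by_cases hex : ∃ i, i ≠ j ∧ i ≠ k ∧ s i ≠ 0
  · obtain ⟨i, hij, hik, hi⟩ := hex
    have hpair : competenceDefect (vertexBias s) k + competenceDefect (vertexBias s) i
        ≤ ∑ k ∈ Finset.univ.erase j, competenceDefect (vertexBias s) k := by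
      rw [← Finset.sum_pair (f := competenceDefect (vertexBias s)) hik.symm]
      refine Finset.sum_le_sum_of_subset_of_nonneg ?_ fun i _ _ =>
        competenceDefect_nonneg (abs_vertexBias_le s) i
      simp [Finset.insert_subset_iff, hkj, hij]
    have hgj := (abs_le.1 (abs_peerBias_le (abs_vertexBias_le s) j)).1
    linarith [hdefect hi]
  · push Not at hex
    have hlead_j : peerLead s j = -1 := by
      rw [peerLead, Finset.sum_eq_single k, hk_coe]
      · intro i hi hik
        rw [hex i (Finset.ne_of_mem_erase hi) hik, SignType.coe_zero]
      · simp [hkj]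
    obtain ⟨l, hlj, hlk⟩ := exists_ne_ne_of_three_le_card hcard j k
    have hgj := neg_quarter_le_peerBias_vertexBias hlj (hex l hlj hlk) hlead_j.ge
    linarith [competenceDefect_le_sum_erase (abs_vertexBias_le s) hkj]

lemma sub_le_sum_competenceDefect_vertexBias (hcard : 3 ≤ Fintype.card ι) (s : ι → SignType)
    (j : ι) : |vertexBias s j| - 2 * peerBias (vertexBias s) j
      ≤ ∑ k, competenceDefect (vertexBias s) k := by
  rw [← Finset.add_sum_erase _ _ (Finset.mem_univ j)]
  have hrest : 0 ≤ ∑ k ∈ Finset.univ.erase j, competenceDefect (vertexBias s) k :=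
    Finset.sum_nonneg fun k _ => competenceDefect_nonneg (abs_vertexBias_le s) k
  have hgj : peerLead s j < 0 ∨ 0 ≤ peerBias (vertexBias s) j :=
    (lt_or_ge _ _).imp_right peerBias_vertexBias_nonneg
  rw [competenceDefect]
  by_cases hj : s j = 0
  · rw [vertexBias_eq_zero hj, abs_zero]
    rcases hgj with hlead | hgj
    · linarith [neg_two_mul_peerBias_vertexBias_le_sum_erase hcard hj hlead]
    · linarith
  · rw [abs_vertexBias_eq hj]
    rcases hgj with hlead | hgj
    · linarith [neg_peerBias_vertexBias_le_sum_erase hcard hlead]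
    · linarith

lemma exists_competenceDefect_update_eq (m : ι → ℝ) (i k : ι) :
    ∃ α β γ : ℝ, ∀ a, competenceDefect (Function.update m i a) k = α + β * a + γ * |a| := by
  rcases eq_or_ne k i with rfl | hki
  · refine ⟨0, 0, 1 - 2 * peerBias m k, fun a => ?_⟩
    rw [competenceDefect, peerBias_update_self, Function.update_self]
    ring
  · obtain ⟨u, v, huv⟩ := exists_peerBias_update_eq m i k
    refine ⟨|m k| * (1 - 2 * u), |m k| * (-2 * v), 0, fun a => ?_⟩
    rw [competenceDefect, huv, Function.update_of_ne hki]
    ring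

theorem sub_le_sum_competenceDefect (hcard : 3 ≤ Fintype.card ι) {m : ι → ℝ}
    (hm : ∀ i, |m i| ≤ 1 / 2) (j : ι) :
    |m j| - 2 * peerBias m j ≤ ∑ k, competenceDefect m k := by
  rw [← sub_nonneg]
  refine nonneg_of_vertexBias_nonneg
    (Φ := fun m => ∑ k, competenceDefect m k - (|m j| - 2 * peerBias m j)) (fun m i => ?_)
    (fun s => sub_nonneg.2 (sub_le_sum_competenceDefect_vertexBias hcard s j)) hm
  choose α β γ hdefect using exists_competenceDefect_update_eq m i
  obtain ⟨u, v, hbias⟩ := exists_peerBias_update_eq m i j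
  obtain ⟨α', γ', habs⟩ := exists_abs_update_eq m i j
  refine ⟨∑ k, α k - α' + 2 * u, ∑ k, β k + 2 * v, ∑ k, γ k - γ', fun a => ?_⟩
  simp only [hdefect, hbias, habs, Finset.sum_add_distrib, ← Finset.sum_mul]
  ring

end Defect

section WeightedError

/-- The error of the vote with score `r` in favour of the true state, a tie counting one half. -/
noncomputable def scoreErr (r : ℝ) : ℝ := (1 - (SignType.sign r : ℝ)) / 2

lemma scoreErr_of_pos {r : ℝ} (h : 0 < r) : scoreErr r = 0 := by simp [scoreErr, h]

lemma scoreErr_nonneg (r : ℝ) : 0 ≤ scoreErr r := by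
  unfold scoreErr
  linarith [(signType_coe_mem_Icc (SignType.sign r)).2]

lemma scoreErr_neg (r : ℝ) : scoreErr (-r) = 1 - scoreErr r := by
  rw [scoreErr, scoreErr, Left.sign_neg, SignType.coe_neg]
  ring

lemma scoreErr_antitone : Antitone scoreErr := fun r s h => by
  have hsign := SignType.sign.monotone h
  unfold scoreErr
  gcongr
  revert hsign
  generalize SignType.sign r = a
  generalize SignType.sign s = b
  cases a <;> cases b <;> simp

/-- The error, up to a factor, of a vote with score `± t + σ` whose signs have likelihoods
proportional to `exp (± t / 2)`. -/
noncomputable def symmetrizedErr (t σ : ℝ) : ℝ :=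
  Real.exp (t / 2) * scoreErr (t + σ) + Real.exp (-(t / 2)) * scoreErr (σ - t)

lemma symmetrizedErr_nonneg (t σ : ℝ) : 0 ≤ symmetrizedErr t σ :=
  add_nonneg (mul_nonneg (Real.exp_pos _).le (scoreErr_nonneg _))
    (mul_nonneg (Real.exp_pos _).le (scoreErr_nonneg _))

lemma symmetrizedErr_neg (t σ : ℝ) : symmetrizedErr (-t) σ = symmetrizedErr t σ := by
  rw [symmetrizedErr, symmetrizedErr, neg_div, neg_neg, sub_neg_eq_add, add_comm σ t,
    neg_add_eq_sub]
  ring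

lemma symmetrizedErr_add_le (t σ : ℝ) :
    symmetrizedErr t σ + symmetrizedErr t (-σ) ≤ 2 * Real.cosh (σ / 2) := by
  wlog ht : 0 ≤ t generalizing t
  · rw [← symmetrizedErr_neg t, ← symmetrizedErr_neg t]
    exact this (-t) (by linarith)
  wlog hσ : 0 ≤ σ generalizing σ
  · have := this (-σ) (by linarith)
    rwa [neg_neg, neg_div, Real.cosh_neg, add_comm] at this
  set S := scoreErr (t + σ) + scoreErr (t - σ) with hS
  have hsum : symmetrizedErr t σ + symmetrizedErr t (-σ)
      = Real.exp (t / 2) * S + Real.exp (-(t / 2)) * (2 - S) := by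
    rw [symmetrizedErr, symmetrizedErr, hS, show σ - t = -(t - σ) by ring,
      show -σ - t = -(t + σ) by ring, scoreErr_neg, scoreErr_neg, ← sub_eq_add_neg]
    ring
  rw [hsum]
  rcases le_or_gt t σ with htσ | htσ
  · have hS_le : S ≤ 1 := by
      have := scoreErr_antitone (by linarith : -(t - σ) ≤ t + σ)
      rw [scoreErr_neg] at this
      linarith
    have hexp : Real.exp (-(t / 2)) ≤ Real.exp (t / 2) := Real.exp_le_exp.2 (by linarith)
    have hcosh : Real.cosh (t / 2) ≤ Real.cosh (σ / 2) :=
      Real.cosh_le_cosh.2 (abs_le_abs_of_nonneg (by linarith) (by linarith))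
    rw [Real.cosh_eq] at hcosh
    nlinarith
  · rw [hS, scoreErr_of_pos (by linarith : 0 < t + σ), scoreErr_of_pos (by linarith : 0 < t - σ)]
    have hexp : Real.exp (-(t / 2)) ≤ 1 := Real.exp_le_one_iff.2 (by linarith)
    linarith [Real.one_le_cosh (σ / 2)]

end WeightedError

section Logit

/-- The logarithm of the odds of a competence `1 / 2 + e`. -/
noncomputable def logit (e : ℝ) : ℝ := Real.log ((1 / 2 + e) / (1 / 2 - e))

lemma logit_neg (e : ℝ) : logit (-e) = -logit e := by
  unfold logit
  rw [← Real.log_inv, inv_div]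
  congr 2
  ring

lemma sqrt_one_sub_pos {e : ℝ} (he : |e| < 1 / 2) : 0 < √(1 - 4 * e ^ 2) := by
  have := abs_lt.1 he
  exact Real.sqrt_pos.2 (by nlinarith)

lemma exp_half_logit {e : ℝ} (he : |e| < 1 / 2) :
    Real.exp (logit e / 2) = (1 + 2 * e) / √(1 - 4 * e ^ 2) := by
  obtain ⟨hlower, hupper⟩ := abs_lt.1 he
  have hnum : 0 < 1 / 2 + e := by linarith
  have hden : 0 < 1 / 2 - e := by linarith
  rw [Real.exp_half, logit, Real.exp_log (div_pos hnum hden),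
    eq_div_iff (sqrt_one_sub_pos he).ne', ← Real.sqrt_mul (div_pos hnum hden).le,
    show (1 / 2 + e) / (1 / 2 - e) * (1 - 4 * e ^ 2) = (1 + 2 * e) ^ 2 by
      rw [div_mul_eq_mul_div, div_eq_iff hden.ne']; ring]
  exact Real.sqrt_sq (by linarith)

lemma exp_neg_half_logit {e : ℝ} (he : |e| < 1 / 2) :
    Real.exp (-(logit e / 2)) = (1 - 2 * e) / √(1 - 4 * e ^ 2) := by
  have := exp_half_logit (e := -e) (by rwa [abs_neg])
  rwa [logit_neg, neg_div, neg_sq, mul_neg, ← sub_eq_add_neg] at this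

lemma half_add_mul_signVal_eq_exp {e : ℝ} (he : |e| < 1 / 2) (u : ℤˣ) :
    1 / 2 + e * signVal u = √(1 - 4 * e ^ 2) * (Real.exp (logit e * signVal u / 2) * (1 / 2)) := by
  have hsqrt := (sqrt_one_sub_pos he).ne'
  have hpos := exp_half_logit he
  have hneg := exp_neg_half_logit he
  generalize √(1 - 4 * e ^ 2) = s at hsqrt hpos hneg ⊢
  rcases signVal_eq_one_or u with hu | hu <;> rw [hu]
  · rw [mul_one, mul_one, hpos]
    field_simp
  · rw [mul_neg_one, mul_neg_one, neg_div, hneg]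
    field_simp
    ring

lemma half_add_mul_exp_half_logit {e : ℝ} (he : |e| < 1 / 2) (a : ℝ) :
    (1 / 2 + a) * Real.exp (logit e / 2) + (1 / 2 - a) * Real.exp (-(logit e / 2))
      = (1 + 4 * a * e) * (√(1 - 4 * e ^ 2))⁻¹ := by
  rw [exp_half_logit he, exp_neg_half_logit he]
  ring

end Logit

section ChernoffBound

variable {ι : Type*} [Fintype ι]

lemma prod_half_sub_abs_le_signMass {m : ι → ℝ} (hm : ∀ i, |m i| ≤ 1 / 2) (x : ι → ℤˣ) :
    ∏ i, (1 / 2 - |m i|) ≤ signMass m x := by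
  refine Finset.prod_le_prod (fun i _ => by linarith [hm i]) fun i _ => ?_
  rcases signVal_eq_one_or (x i) with h | h <;> rw [h]
  · linarith [neg_abs_le (m i)]
  · linarith [le_abs_self (m i)]

variable [DecidableEq ι]

/-- Pairing `x` with `-x` bounds the mean of `F` by `max (signMass m x) (signMass m (-x)) * G x`,
and the smaller of the two masses is at least `∏ i, (1 / 2 - |m i|)`. -/
lemma signMean_le_of_add_neg_le {m : ι → ℝ} (hm : ∀ i, |m i| ≤ 1 / 2) {F G : (ι → ℤˣ) → ℝ}
    (hF : ∀ x, 0 ≤ F x) (hFG : ∀ x, F x + F (-1 * x) ≤ G x) (hG : ∀ x, G (-1 * x) = G x) :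
    signMean m F ≤ signMean m G - 1 / 2 * (∏ i, (1 - 2 * |m i|)) * signMean 0 G := by
  set κ := ∏ i, (1 / 2 - |m i|) with hκ
  have hpair (x : ι → ℤˣ) : signMass m x * F x + signMass m (-1 * x) * F (-1 * x)
      ≤ (signMass m x + signMass m (-1 * x) - κ) * G x := by
    have hx := prod_half_sub_abs_le_signMass hm x
    have hnx := prod_half_sub_abs_le_signMass hm (-1 * x)
    have hFx := mul_nonneg (sub_nonneg.2 hnx) (hF x)
    have hFnx := mul_nonneg (sub_nonneg.2 hx) (hF (-1 * x))
    have hGx := mul_nonneg (by linarith [signMass_nonneg hm x] :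
      0 ≤ signMass m x + signMass m (-1 * x) - κ) (sub_nonneg.2 (hFG x))
    linarith
  have hsum := Finset.sum_le_sum fun x (_ : x ∈ Finset.univ) => hpair x
  have hnegF := sum_mul_left_sign (-1) fun x => signMass m x * F x
  have hnegG := sum_mul_left_sign (-1) fun x => signMass m x * G x
  simp only [hG] at hnegG
  simp only [sub_mul, add_mul, Finset.sum_add_distrib, Finset.sum_sub_distrib, hnegF, hnegG,
    ← Finset.mul_sum] at hsum
  have hfair : (∏ i, (1 - 2 * |m i|)) * signMean 0 G = κ * ∑ x, G x := by
    have hmass (x : ι → ℤˣ) : (∏ i, (1 - 2 * |m i|)) * signMass 0 x = κ := by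
      rw [signMass, hκ, ← Finset.prod_mul_distrib]
      exact Finset.prod_congr rfl fun i _ => by rw [Pi.zero_apply]; ring
    simp only [signMean, Finset.mul_sum, ← mul_assoc, hmass]
  rw [mul_assoc, hfair]
  unfold signMean
  linarith

lemma signMean_prod (W : Finset ι) (m : ι → ℝ) (f : ι → ℤˣ → ℝ) :
    signMean m (fun x => ∏ i ∈ W, f i (x i))
      = ∏ i ∈ W, ((1 / 2 + m i) * f i 1 + (1 / 2 - m i) * f i (-1)) := by
  have hite (x : ι → ℤˣ) : signMass m x * ∏ i ∈ W, f i (x i)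
      = ∏ i, (1 / 2 + m i * signVal (x i)) * (if i ∈ W then f i (x i) else 1) := by
    rw [Finset.prod_mul_distrib, Finset.prod_ite_mem, Finset.univ_inter, signMass]
  simp only [signMean, hite]
  rw [sum_prod_sign fun i u => (1 / 2 + m i * signVal u) * (if i ∈ W then f i u else 1),
    ← Finset.prod_subset (Finset.subset_univ W)]
  · exact Finset.prod_congr rfl fun i hi => by simp [hi, sub_eq_add_neg]
  · exact fun i _ hi => by simp [hi]; ring

lemma signMean_two_mul_cosh (W : Finset ι) (m : ι → ℝ) {e : ι → ℝ} (he : ∀ i, |e i| < 1 / 2) :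
    signMean m (fun x => 2 * Real.cosh ((∑ i ∈ W, logit (e i) * signVal (x i)) / 2))
      = (∏ i ∈ W, (√(1 - 4 * e i ^ 2))⁻¹) *
        (∏ i ∈ W, (1 + 4 * m i * e i) + ∏ i ∈ W, (1 - 4 * m i * e i)) := by
  have hcosh (x : ι → ℤˣ) : 2 * Real.cosh ((∑ i ∈ W, logit (e i) * signVal (x i)) / 2)
      = ∏ i ∈ W, Real.exp (logit (e i) * signVal (x i) / 2)
        + ∏ i ∈ W, Real.exp (-(logit (e i) * signVal (x i) / 2)) := by
    rw [Real.cosh_eq, ← Real.exp_sum, ← Real.exp_sum, Finset.sum_neg_distrib, Finset.sum_div]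
    ring
  simp only [hcosh]
  rw [signMean_add, signMean_prod W m fun i u => Real.exp (logit (e i) * signVal u / 2),
    signMean_prod W m fun i u => Real.exp (-(logit (e i) * signVal u / 2)), mul_add,
    ← Finset.prod_mul_distrib, ← Finset.prod_mul_distrib]
  congr 1 <;> refine Finset.prod_congr rfl fun i _ => ?_
  · rw [mul_comm _ (1 + _), ← half_add_mul_exp_half_logit (he i)]
    simp [neg_div]
  · rw [mul_comm _ (1 - _), show 1 - 4 * m i * e i = 1 + 4 * (-m i) * e i by ring,
      ← half_add_mul_exp_half_logit (he i)]
    simp [neg_div]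
    ring

lemma signMass_eq_exp_mul_signMass (W : Finset ι) {m e : ι → ℝ} (he : ∀ i, |e i| < 1 / 2)
    (hme : ∀ i ∉ W, m i = e i) (x : ι → ℤˣ) :
    signMass m x = (∏ i ∈ Wᶜ, √(1 - 4 * e i ^ 2)) *
      (signMass (W.piecewise m 0) x * Real.exp ((∑ i ∈ Wᶜ, logit (e i) * signVal (x i)) / 2)) := by
  rw [signMass, signMass, ← Finset.prod_mul_prod_compl W, ← Finset.prod_mul_prod_compl W,
    Finset.sum_div, Real.exp_sum, mul_assoc, mul_left_comm, ← Finset.prod_mul_distrib,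
    ← Finset.prod_mul_distrib]
  congr 1 <;> refine Finset.prod_congr rfl fun i hi => ?_
  · rw [Finset.piecewise_eq_of_mem _ _ _ hi]
  · have hiW := Finset.mem_compl.1 hi
    rw [Finset.piecewise_eq_of_notMem _ _ _ hiW, Pi.zero_apply, hme i hiW,
      half_add_mul_signVal_eq_exp (he i)]
    ring

/-- Reversing the coordinates outside `W` symmetrizes the score that comes from them. -/
lemma signMean_scoreErr_eq (W : Finset ι) {m e : ι → ℝ} (he : ∀ i, |e i| < 1 / 2)
    (hme : ∀ i ∉ W, m i = e i) :
    signMean m (fun x => scoreErr (∑ i, logit (e i) * signVal (x i)))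
      = 1 / 2 * (∏ i ∈ Wᶜ, √(1 - 4 * e i ^ 2)) * signMean (W.piecewise m 0) (fun x =>
        symmetrizedErr (∑ i ∈ Wᶜ, logit (e i) * signVal (x i))
          (∑ i ∈ W, logit (e i) * signVal (x i))) := by
  set t : (ι → ℤˣ) → ℝ := fun x => ∑ i ∈ Wᶜ, logit (e i) * signVal (x i) with ht
  set σ : (ι → ℤˣ) → ℝ := fun x => ∑ i ∈ W, logit (e i) * signVal (x i)
  set F : (ι → ℤˣ) → ℝ := fun x => Real.exp (t x / 2) * scoreErr (t x + σ x) with hF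
  have htilt : signMean m (fun x => scoreErr (∑ i, logit (e i) * signVal (x i)))
      = (∏ i ∈ Wᶜ, √(1 - 4 * e i ^ 2)) * signMean (W.piecewise m 0) F := by
    rw [signMean, signMean, Finset.mul_sum]
    refine Finset.sum_congr rfl fun x _ => ?_
    rw [signMass_eq_exp_mul_signMass W he hme, ← Finset.sum_compl_add_sum W]
    ring
  set r : ι → ℤˣ := W.piecewise 1 (-1) with hr
  have hlaw : (fun i => signVal (r i) * W.piecewise m 0 i) = W.piecewise m 0 := by
    ext i
    by_cases hi : i ∈ W <;> simp [hr, hi]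
  have htr (x : ι → ℤˣ) : t (r * x) = -t x := by
    rw [ht, ← Finset.sum_neg_distrib]
    exact Finset.sum_congr rfl fun i hi => by simp [hr, Finset.mem_compl.1 hi]
  have hσr (x : ι → ℤˣ) : σ (r * x) = σ x :=
    Finset.sum_congr rfl fun i hi => by simp [hr, hi]
  have hflip := signMean_mul_left (W.piecewise m 0) r F
  rw [hlaw] at hflip
  have hsym : signMean (W.piecewise m 0) (fun x => symmetrizedErr (t x) (σ x))
      = signMean (W.piecewise m 0) F + signMean (W.piecewise m 0) (fun x => F (r * x)) := by
    rw [← signMean_add]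
    simp only [hF, htr, hσr, symmetrizedErr, neg_div, neg_add_eq_sub]
  rw [htilt, hsym, hflip]
  ring

/-- The weights `logit (e i)` are ideal for the coordinates outside `W`; the law of the
coordinates in `W` is arbitrary. -/
theorem signMean_scoreErr_le (W : Finset ι) {m e : ι → ℝ} (hm : ∀ i, |m i| ≤ 1 / 2)
    (he : ∀ i, |e i| < 1 / 2) (hme : ∀ i ∉ W, m i = e i) :
    signMean m (fun x => scoreErr (∑ i, logit (e i) * signVal (x i))) ≤
      1 / 2 * (∏ i ∈ Wᶜ, √(1 - 4 * e i ^ 2)) * (∏ i ∈ W, (√(1 - 4 * e i ^ 2))⁻¹) *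
        (∏ i ∈ W, (1 + 4 * m i * e i) + ∏ i ∈ W, (1 - 4 * m i * e i)
          - ∏ i ∈ W, (1 - 2 * |m i|)) := by
  have hm' (i : ι) : |W.piecewise m 0 i| ≤ 1 / 2 := by
    by_cases hi : i ∈ W
    · simpa [hi] using hm i
    · simp [hi]
  have hneg (V : Finset ι) (x : ι → ℤˣ) : ∑ i ∈ V, logit (e i) * signVal ((-1 * x) i)
      = -∑ i ∈ V, logit (e i) * signVal (x i) := by
    rw [← Finset.sum_neg_distrib]
    exact Finset.sum_congr rfl fun i _ => by simp
  have hsym := signMean_le_of_add_neg_le hm'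
    (F := fun x => symmetrizedErr (∑ i ∈ Wᶜ, logit (e i) * signVal (x i))
      (∑ i ∈ W, logit (e i) * signVal (x i)))
    (G := fun x => 2 * Real.cosh ((∑ i ∈ W, logit (e i) * signVal (x i)) / 2))
    (fun x => symmetrizedErr_nonneg _ _)
    (fun x => by rw [hneg, hneg, symmetrizedErr_neg]; exact symmetrizedErr_add_le _ _)
    (fun x => by rw [hneg, neg_div, Real.cosh_neg])
  have hprod (f : ℝ → ℝ → ℝ) :
      ∏ i ∈ W, f (W.piecewise m 0 i) (e i) = ∏ i ∈ W, f (m i) (e i) :=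
    Finset.prod_congr rfl fun i hi => by rw [Finset.piecewise_eq_of_mem _ _ _ hi]
  have hrest : ∏ i, (1 - 2 * |W.piecewise m 0 i|) = ∏ i ∈ W, (1 - 2 * |m i|) := by
    rw [← hprod fun a _ => 1 - 2 * |a|, Finset.prod_subset (Finset.subset_univ W)]
    exact fun i _ hi => by simp [hi]
  rw [signMean_two_mul_cosh W _ he, signMean_two_mul_cosh W _ he, hrest,
    hprod fun a b => 1 + 4 * a * b, hprod fun a b => 1 - 4 * a * b] at hsym
  simp only [Pi.zero_apply, mul_zero, zero_mul, add_zero, sub_zero, Finset.prod_const_one] at hsym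
  rw [signMean_scoreErr_eq W he hme, mul_assoc _ (∏ i ∈ W, (√(1 - 4 * e i ^ 2))⁻¹)]
  refine mul_le_mul_of_nonneg_left (by linarith) ?_
  exact mul_nonneg (by norm_num) (Finset.prod_nonneg fun i _ => Real.sqrt_nonneg _)

end ChernoffBound

section LogCorrection

lemma logit_eq_log_sub_log {e : ℝ} (he : |e| < 1 / 2) :
    logit e = Real.log (1 + 2 * e) - Real.log (1 - 2 * e) := by
  obtain ⟨hlower, hupper⟩ := abs_lt.1 he
  rw [logit, ← Real.log_div (by linarith) (by linarith),
    show (1 / 2 + e) / (1 / 2 - e) = (1 + 2 * e) / (1 - 2 * e) by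
      rw [div_eq_div_iff (by linarith) (by linarith)]; ring]

lemma abs_mul_logit_abs (e : ℝ) : |e| * logit |e| = e * logit e := by
  rcases abs_choice e with h | h <;> rw [h]
  rw [logit_neg, neg_mul_neg]

lemma log_sqrt_one_sub {e : ℝ} (he : |e| < 1 / 2) :
    Real.log √(1 - 4 * e ^ 2) = (Real.log (1 + 2 * |e|) + Real.log (1 - 2 * |e|)) / 2 := by
  have habs := abs_nonneg e
  rw [← sq_abs, show 1 - 4 * |e| ^ 2 = (1 + 2 * |e|) * (1 - 2 * |e|) by ring,
    Real.log_sqrt (mul_nonneg (by linarith) (by linarith)),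
    Real.log_mul (by linarith) (by linarith)]

lemma hasDerivAt_two_add_mul_log {x : ℝ} (hx : x ∈ Set.Ico (0 : ℝ) 1) :
    HasDerivAt (fun z => (2 + z) * Real.log (1 + z) + (2 - z) * Real.log (1 - z))
      (Real.log ((1 + x) / (1 - x)) - ((1 + x) / (1 - x) - ((1 + x) / (1 - x))⁻¹) / 2) x := by
  have hadd : 0 < 1 + x := by linarith [hx.1]
  have hsub : 0 < 1 - x := by linarith [hx.2]
  have hderiv := (((hasDerivAt_id x).const_add 2).mul
    (((hasDerivAt_id x).const_add 1).log hadd.ne')).add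
    (((hasDerivAt_id x).const_sub 2).mul (((hasDerivAt_id x).const_sub 1).log hsub.ne'))
  refine hderiv.congr_deriv ?_
  simp only [id]
  rw [Real.log_div hadd.ne' hsub.ne']
  field_simp
  ring

lemma two_add_mul_log_le {z : ℝ} (hz : z ∈ Set.Ico (0 : ℝ) 1) :
    (2 + z) * Real.log (1 + z) + (2 - z) * Real.log (1 - z) ≤ 0 := by
  have hanti : AntitoneOn
      (fun z => (2 + z) * Real.log (1 + z) + (2 - z) * Real.log (1 - z)) (Set.Ico (0 : ℝ) 1) := by
    refine antitoneOn_of_hasDerivWithinAt_nonpos (convex_Ico 0 1)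
      (fun x hx => (hasDerivAt_two_add_mul_log hx).continuousAt.continuousWithinAt)
      (fun x hx => (hasDerivAt_two_add_mul_log (interior_subset hx)).hasDerivWithinAt)
      fun x hx => ?_
    have hx' := interior_subset hx
    have hodds : 1 ≤ (1 + x) / (1 - x) := by
      rw [one_le_div (by linarith [hx'.2])]
      linarith [hx'.1]
    rw [← Real.sinh_log (one_pos.trans_le hodds), sub_nonpos]
    exact Real.self_le_sinh_iff.2 (Real.log_nonneg hodds)
  simpa using hanti (Set.left_mem_Ico.2 one_pos) hz hz.1

lemma sqrt_one_sub_le_exp {e : ℝ} (he : |e| < 1 / 2) :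
    √(1 - 4 * e ^ 2) ≤ Real.exp (-(e * logit e) / 2) := by
  have habs := abs_nonneg e
  have hlog := two_add_mul_log_le (z := 2 * |e|) ⟨by linarith, by linarith⟩
  rw [← Real.log_le_iff_le_exp (sqrt_one_sub_pos he), log_sqrt_one_sub he, ← abs_mul_logit_abs,
    logit_eq_log_sub_log (by rwa [abs_abs])]
  linarith

/-- The logarithm of `exp (e * logit e / 2) / √(1 - 4 * e ^ 2)` for `z = 2 * |e|`, the factor lost
on a coordinate whose likelihood ratio is not used. -/
noncomputable def logCorrection (z : ℝ) : ℝ :=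
  1 / 4 * ((1 + z) * Real.log (1 + z) + (1 - z) * Real.log (1 - z))
    - 3 / 4 * (Real.log (1 + z) + Real.log (1 - z))

lemma inv_sqrt_one_sub {e : ℝ} (he : |e| < 1 / 2) :
    (√(1 - 4 * e ^ 2))⁻¹ = Real.exp (-(e * logit e) / 2) * Real.exp (logCorrection (2 * |e|)) := by
  rw [← Real.exp_add, ← Real.exp_log (inv_pos.2 (sqrt_one_sub_pos he)), Real.log_inv,
    log_sqrt_one_sub he, ← abs_mul_logit_abs, logit_eq_log_sub_log (by rwa [abs_abs]),
    logCorrection]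
  congr 1
  ring

lemma convexOn_logCorrection : ConvexOn ℝ (Set.Ioo (-1) 1) logCorrection := by
  have hhalf : ConvexOn ℝ (Set.Ioi 0) fun z => 1 / 4 * (z * Real.log z) - 3 / 4 * Real.log z :=
    ((Real.convexOn_mul_log.subset Set.Ioi_subset_Ici_self (convex_Ioi 0)).smul
      (by norm_num)).sub (strictConcaveOn_log_Ioi.concaveOn.smul (by norm_num))
  have hadd := (hhalf.translate_right 1).subset (s := Set.Ioo (-1) 1)
    (fun z hz => by simp only [Set.mem_preimage, Set.mem_Ioi]; linarith [hz.1]) (convex_Ioo _ _)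
  have hsub := ((hhalf.translate_right 1).comp_linearMap (-LinearMap.id)).subset
    (s := Set.Ioo (-1) 1)
    (fun z hz => by
      simp only [Set.mem_preimage, Set.mem_Ioi, LinearMap.neg_apply, LinearMap.id_apply]
      linarith [hz.2])
    (convex_Ioo _ _)
  refine (hadd.add hsub).congr fun z _ => ?_
  simp only [logCorrection, Pi.add_apply, Function.comp_apply, LinearMap.neg_apply,
    LinearMap.id_apply, ← sub_eq_add_neg]
  ring

lemma logCorrection_zero : logCorrection 0 = 0 := by simp [logCorrection]

lemma logCorrection_half_le : logCorrection (1 / 2) ≤ 9 / 32 := by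
  have hhalf : logCorrection (1 / 2) = Real.log 2 - 3 / 8 * Real.log 3 := by
    unfold logCorrection
    rw [show (1 : ℝ) + 1 / 2 = 3 / 2 by norm_num, show (1 : ℝ) - 1 / 2 = 1 / 2 by norm_num,
      Real.log_div (by norm_num) (by norm_num), Real.log_div (by norm_num) (by norm_num),
      Real.log_one]
    ring
  have hlog : 32 * Real.log 2 - 12 * Real.log 3 ≤ 9 := by
    have hratio : (32 : ℝ) * Real.log 2 - 12 * Real.log 3 = Real.log (2 ^ 32 / 3 ^ 12) := by
      rw [Real.log_div (by positivity) (by positivity), Real.log_pow, Real.log_pow]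
      norm_num
    rw [hratio, Real.log_le_iff_le_exp (by positivity), show (9 : ℝ) = (9 : ℕ) * 1 by norm_num,
      Real.exp_nat_mul]
    calc (2 : ℝ) ^ 32 / 3 ^ 12 ≤ 2.7182818283 ^ 9 := by norm_num
      _ ≤ Real.exp 1 ^ 9 := by gcongr; exact Real.exp_one_gt_d9.le
  rw [hhalf]
  linarith

lemma log_four_ninths_le : Real.log (4 / 9) ≤ -0.8 := by
  rw [Real.log_le_iff_le_exp (by norm_num), Real.exp_neg,
    le_inv_comm₀ (by norm_num) (Real.exp_pos _)]
  refine (pow_le_pow_iff_left₀ (Real.exp_pos _).le (by norm_num) (by norm_num : 5 ≠ 0)).1 ?_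
  rw [← Real.exp_nat_mul, show ((5 : ℕ) : ℝ) * 0.8 = (4 : ℕ) * 1 by norm_num, Real.exp_nat_mul]
  calc Real.exp 1 ^ 4 ≤ 2.7182818286 ^ 4 := by gcongr; exact Real.exp_one_lt_d9.le
    _ ≤ _ := by norm_num

lemma logCorrection_five_ninths_le : logCorrection (5 / 9) ≤ 13 / 32 := by
  have hadd : Real.log (14 / 9) ≤ 0.46 := by
    rw [Real.log_le_iff_le_exp (by norm_num)]
    exact le_trans (by norm_num) (Real.quadratic_le_exp_of_nonneg (by norm_num))
  have hprod : -Real.log (14 / 9) - Real.log (4 / 9) ≤ 0.4 := by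
    have hinv : -Real.log (14 / 9) - Real.log (4 / 9) = Real.log (81 / 56) := by
      rw [← Real.log_inv, ← Real.log_div (by norm_num) (by norm_num)]
      norm_num
    rw [hinv, Real.log_le_iff_le_exp (by norm_num)]
    exact le_trans (by norm_num) (Real.quadratic_le_exp_of_nonneg (by norm_num))
  have hsub := log_four_ninths_le
  unfold logCorrection
  norm_num at *
  linarith

/-- The convex function `logCorrection` is below its chords over `[0, 1/2]` and `[1/2, 5/9]`. -/
lemma logCorrection_le {e y : ℝ} (he₀ : 0 ≤ e) (hy₀ : 0 ≤ y) (hy : y ≤ 1 / 6)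
    (he : e ≤ 1 / 4 + y ^ 2) : logCorrection (2 * e) ≤ 9 / 8 * (e + y / 2) := by
  have hhalf := logCorrection_half_le
  rcases le_total e (1 / 4) with h | h
  · have hchord := convexOn_logCorrection.2 (show (0 : ℝ) ∈ Set.Ioo (-1) 1 by norm_num)
      (show (1 / 2 : ℝ) ∈ Set.Ioo (-1) 1 by norm_num) (show 0 ≤ 1 - 4 * e by linarith)
      (show 0 ≤ 4 * e by linarith) (by ring)
    simp only [smul_eq_mul, logCorrection_zero] at hchord
    rw [show (1 - 4 * e) * 0 + 4 * e * (1 / 2) = 2 * e by ring] at hchord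
    nlinarith
  · have he' : e ≤ 5 / 18 := by nlinarith
    have hchord := convexOn_logCorrection.2 (show (1 / 2 : ℝ) ∈ Set.Ioo (-1) 1 by norm_num)
      (show (5 / 9 : ℝ) ∈ Set.Ioo (-1) 1 by norm_num) (show 0 ≤ 10 - 36 * e by linarith)
      (show 0 ≤ 36 * e - 9 by linarith) (by ring)
    simp only [smul_eq_mul] at hchord
    rw [show (10 - 36 * e) * (1 / 2) + (36 * e - 9) * (5 / 9) = 2 * e by ring] at hchord
    have hleft := mul_le_mul_of_nonneg_left hhalf (by linarith : 0 ≤ 10 - 36 * e)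
    have hright := mul_le_mul_of_nonneg_left logCorrection_five_ninths_le
      (by linarith : 0 ≤ 36 * e - 9)
    nlinarith

end LogCorrection

section CorrectionFactor

lemma two_mul_cosh_le_quartic {u : ℝ} (hu : |u| ≤ 1) :
    2 * Real.cosh u ≤ 2 + u ^ 2 + 5 / 48 * u ^ 4 := by
  have hpos := (abs_le.1 (Real.exp_bound hu (n := 4) (by norm_num))).2
  have hneg := (abs_le.1 (Real.exp_bound (x := -u) (by rwa [abs_neg]) (n := 4) (by norm_num))).2
  have habs : |u| ^ 4 = u ^ 4 := (show Even 4 by decide).pow_abs u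
  rw [abs_neg] at hneg
  rw [habs] at hpos hneg
  simp only [Finset.sum_range_succ, Finset.sum_range_zero, Nat.factorial] at hpos hneg
  norm_num at hpos hneg
  rw [Real.cosh_eq]
  nlinarith

lemma exp_nine_eighths_le : Real.exp (9 / 8) ≤ 3.081 := by
  refine (pow_le_pow_iff_left₀ (Real.exp_pos _).le (by norm_num) (by norm_num : 8 ≠ 0)).1 ?_
  rw [← Real.exp_nat_mul, show ((8 : ℕ) : ℝ) * (9 / 8) = (9 : ℕ) * 1 by norm_num,
    Real.exp_nat_mul]
  calc Real.exp 1 ^ 9 ≤ 2.7182818286 ^ 9 := by gcongr; exact Real.exp_one_lt_d9.le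
    _ ≤ _ := by norm_num

/-- The correction factor when all the bias of the unreliable coordinates is `u`. -/
noncomputable def coshCorrection (u : ℝ) : ℝ := 2 * Real.cosh u - max (1 - 2 * u) 0

lemma coshCorrection_nonneg {u : ℝ} (hu : 0 ≤ u) : 0 ≤ coshCorrection u := by
  have hmax : max (1 - 2 * u) 0 ≤ 1 := max_le (by linarith) zero_le_one
  unfold coshCorrection
  linarith [Real.one_le_cosh u]

lemma coshCorrection_le {u : ℝ} (hu₀ : 0 ≤ u) (hu₁ : u ≤ 1) : coshCorrection u ≤ 1 + 3 * u := by
  have hcosh := two_mul_cosh_le_quartic (u := u) (by rwa [abs_of_nonneg hu₀])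
  unfold coshCorrection
  rcases le_total u (1 / 2) with h | h
  · have hsq : u ^ 2 ≤ u / 2 := by nlinarith
    have hquartic : u ^ 4 ≤ u / 4 := by nlinarith
    linarith [le_max_left (1 - 2 * u) 0]
  · have hsq : u ^ 2 ≤ 3 / 2 * u - 1 / 2 := by nlinarith
    have hquartic : u ^ 4 ≤ 1 := pow_le_one₀ hu₀ hu₁
    linarith [le_max_right (1 - 2 * u) 0]

lemma coshCorrection_le_exp {u : ℝ} (hu₀ : 0 ≤ u) (hu₁ : u ≤ 1) :
    3.081 * coshCorrection u ≤ 4 * Real.exp (9 / 8 * u) := by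
  have hcosh := two_mul_cosh_le_quartic (u := u) (by rwa [abs_of_nonneg hu₀])
  have hsq : 0 ≤ u ^ 2 := by positivity
  have hexp : 1 + 9 / 8 * u + 81 / 128 * u ^ 2 + 243 / 1024 * u ^ 3 ≤ Real.exp (9 / 8 * u) := by
    have htaylor := Real.sum_le_exp_of_nonneg (x := 9 / 8 * u) (by linarith) 4
    simp only [Finset.sum_range_succ, Finset.sum_range_zero, Nat.factorial] at htaylor
    norm_num at htaylor
    nlinarith
  unfold coshCorrection
  rcases le_total u (1 / 2) with h | h
  · have hcube : 0 ≤ u ^ 3 := by positivity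
    have hsq' : u ^ 2 ≤ u / 2 := by nlinarith
    have hquartic : u ^ 4 ≤ u ^ 3 / 2 := by nlinarith
    nlinarith [le_max_left (1 - 2 * u) 0]
  · have hcube : 1 / 8 ≤ u ^ 3 := by
      calc (1 / 8 : ℝ) = (1 / 2) ^ 3 := by norm_num
        _ ≤ u ^ 3 := by gcongr
    have hquartic : u ^ 4 ≤ 15 / 8 * u - 7 / 8 := by
      have hprod := mul_nonneg (sub_nonneg.2 h) (sub_nonneg.2 hu₁)
      nlinarith [mul_nonneg hprod hsq, mul_nonneg hprod hu₀]
    nlinarith [le_max_right (1 - 2 * u) 0]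

/-- Convexity in `E` reduces the claim to the ends `E = 0` and `E = 1 - u`. -/
lemma exp_mul_coshCorrection_le {u E : ℝ} (hu : 0 ≤ u) (hE : 0 ≤ E) (h : u + E ≤ 1) :
    Real.exp (9 / 8 * E) * coshCorrection u ≤ 1 + 3 * (u + E) := by
  have hu₁ : u ≤ 1 := by linarith
  have hnonneg := coshCorrection_nonneg hu
  rcases hu₁.eq_or_lt with rfl | hu₁'
  · obtain rfl : E = 0 := by linarith
    simpa using coshCorrection_le hu hu₁
  have hend : Real.exp (9 / 8 * (1 - u)) * coshCorrection u ≤ 4 := by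
    rw [show 9 / 8 * (1 - u) = 9 / 8 - 9 / 8 * u by ring, Real.exp_sub, div_mul_eq_mul_div,
      div_le_iff₀ (Real.exp_pos _)]
    exact (mul_le_mul_of_nonneg_right exp_nine_eighths_le hnonneg).trans
      (coshCorrection_le_exp hu hu₁)
  obtain ⟨l, hl₀, hl₁, rfl⟩ : ∃ l, 0 ≤ l ∧ l ≤ 1 ∧ l * (1 - u) = E :=
    ⟨E / (1 - u), div_nonneg hE (by linarith), (div_le_one (by linarith)).2 (by linarith),
      div_mul_cancel₀ _ (by linarith)⟩
  have hconvex := convexOn_exp.2 (Set.mem_univ 0) (Set.mem_univ (9 / 8 * (1 - u)))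
    (sub_nonneg.2 hl₁) hl₀ (by ring)
  simp only [smul_eq_mul, mul_zero, zero_add, Real.exp_zero, mul_one] at hconvex
  calc Real.exp (9 / 8 * (l * (1 - u))) * coshCorrection u
      ≤ (1 - l + l * Real.exp (9 / 8 * (1 - u))) * coshCorrection u := by
        rw [mul_left_comm]
        exact mul_le_mul_of_nonneg_right hconvex hnonneg
    _ = (1 - l) * coshCorrection u + l * (Real.exp (9 / 8 * (1 - u)) * coshCorrection u) := by
        ring
    _ ≤ (1 - l) * (1 + 3 * u) + l * 4 := by
        gcongr
        exact coshCorrection_le hu hu₁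
    _ = 1 + 3 * (u + l * (1 - u)) := by ring

variable {ι : Type*} (W : Finset ι)

lemma prod_one_add_prod_one_sub_le_cosh_sinh {v : ι → ℝ} (hv : ∀ i ∈ W, 0 ≤ v i) :
    ∏ i ∈ W, (1 + v i) + ∏ i ∈ W, (1 - v i) ≤ 2 * Real.cosh (∑ i ∈ W, v i) ∧
    ∏ i ∈ W, (1 + v i) - ∏ i ∈ W, (1 - v i) ≤ 2 * Real.sinh (∑ i ∈ W, v i) := by
  induction W using Finset.cons_induction with
  | empty => norm_num
  | cons i W hi ih =>
    rw [Finset.forall_mem_cons] at hv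
    obtain ⟨hcosh, hsinh⟩ := ih hv.2
    rw [Finset.prod_cons, Finset.prod_cons, Finset.sum_cons, Real.cosh_add, Real.sinh_add]
    have hvi := Real.self_le_sinh_iff.2 hv.1
    have hvi' := Real.one_le_cosh (v i)
    have hc := (Real.cosh_pos (∑ i ∈ W, v i)).le
    have hs := Real.sinh_nonneg_iff.2 (Finset.sum_nonneg hv.2)
    constructor
    · nlinarith [mul_le_mul_of_nonneg_left hsinh hv.1, mul_le_mul_of_nonneg_right hvi hs,
        mul_le_mul_of_nonneg_right hvi' hc]
    · nlinarith [mul_le_mul_of_nonneg_left hcosh hv.1, mul_le_mul_of_nonneg_right hvi hc,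
        mul_le_mul_of_nonneg_right hvi' hs]

lemma one_sub_sum_le_prod_one_sub {v : ι → ℝ} (hv₀ : ∀ i ∈ W, 0 ≤ v i) (hv₁ : ∀ i ∈ W, v i ≤ 1) :
    1 - ∑ i ∈ W, v i ≤ ∏ i ∈ W, (1 - v i) := by
  induction W using Finset.cons_induction with
  | empty => simp
  | cons i W hi ih =>
    rw [Finset.forall_mem_cons] at hv₀ hv₁
    rw [Finset.prod_cons, Finset.sum_cons]
    nlinarith [ih hv₀.2 hv₁.2, mul_nonneg hv₀.1 (Finset.sum_nonneg hv₀.2)]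

lemma prod_add_prod_sub_prod_le_coshCorrection {v b : ι → ℝ} {s : ℝ} (hv : ∀ i ∈ W, 0 ≤ v i)
    (hvs : ∑ i ∈ W, v i ≤ s) (hb₀ : ∀ i ∈ W, 0 ≤ b i) (hb₁ : ∀ i ∈ W, b i ≤ 1)
    (hbs : ∑ i ∈ W, b i ≤ 2 * s) :
    ∏ i ∈ W, (1 + v i) + ∏ i ∈ W, (1 - v i) - ∏ i ∈ W, (1 - b i) ≤ coshCorrection s := by
  have hv_sum := Finset.sum_nonneg hv
  have hcosh : Real.cosh (∑ i ∈ W, v i) ≤ Real.cosh s :=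
    Real.cosh_le_cosh.2 (abs_le_abs_of_nonneg hv_sum hvs)
  have hmax : max (1 - 2 * s) 0 ≤ ∏ i ∈ W, (1 - b i) :=
    max_le (by linarith [one_sub_sum_le_prod_one_sub W hb₀ hb₁])
      (Finset.prod_nonneg fun i hi => sub_nonneg.2 (hb₁ i hi))
  unfold coshCorrection
  linarith [(prod_one_add_prod_one_sub_le_cosh_sinh W hv).1]

/-- The factor by which the coordinates in `W`, of bias `∓ a i` and weight `± logit (e i)`, increase
the bound `exp (-Φ / 2) / 2` on the error of a vote with ideal weights. -/
noncomputable def correctionFactor (a e : ι → ℝ) : ℝ :=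
  (∏ i ∈ W, Real.exp (logCorrection (2 * e i))) *
    (∏ i ∈ W, (1 + 4 * a i * e i) + ∏ i ∈ W, (1 - 4 * a i * e i) - ∏ i ∈ W, (1 - 2 * a i))

lemma correctionFactor_congr_left {a b : ι → ℝ} (e : ι → ℝ) (h : ∀ i ∈ W, a i = b i) :
    correctionFactor W a e = correctionFactor W b e := by
  unfold correctionFactor
  congr 2
  · congr 1 <;> exact Finset.prod_congr rfl fun i hi => by rw [h i hi]
  · exact Finset.prod_congr rfl fun i hi => by rw [h i hi]

lemma correctionFactor_nonneg {a e : ι → ℝ} (ha₀ : ∀ i ∈ W, 0 ≤ a i) (ha : ∀ i ∈ W, a i ≤ 1 / 2)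
    (he₀ : ∀ i ∈ W, 0 ≤ e i) (he : ∀ i ∈ W, e i ≤ 1 / 2) : 0 ≤ correctionFactor W a e := by
  have hadd : ∏ i ∈ W, (1 - 2 * a i) ≤ ∏ i ∈ W, (1 + 4 * a i * e i) :=
    Finset.prod_le_prod (fun i hi => by linarith [ha i hi]) fun i hi => by
      nlinarith [ha₀ i hi, mul_nonneg (ha₀ i hi) (he₀ i hi)]
  have hsub : 0 ≤ ∏ i ∈ W, (1 - 4 * a i * e i) := Finset.prod_nonneg fun i hi => by
    nlinarith [mul_le_mul (ha i hi) (he i hi) (he₀ i hi) (by norm_num)]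
  exact mul_nonneg (Finset.prod_nonneg fun i _ => (Real.exp_pos _).le) (by linarith)

theorem correctionFactor_le {a e y : ι → ℝ} (ha₀ : ∀ i ∈ W, 0 ≤ a i)
    (ha : ∀ i ∈ W, a i ≤ 1 / 2) (he₀ : ∀ i ∈ W, 0 ≤ e i) (hy₀ : ∀ i ∈ W, 0 ≤ y i)
    (hy : ∀ i ∈ W, y i ≤ 1 / 6) (he : ∀ i ∈ W, e i ≤ 1 / 4 + y i ^ 2)
    (hsum : ∑ i ∈ W, (a i + e i) + 5 / 6 * ∑ i ∈ W, y i ≤ 1) :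
    correctionFactor W a e ≤ 1 + 3 * ∑ i ∈ W, (a i + e i) + 5 / 2 * ∑ i ∈ W, y i := by
  rw [Finset.sum_add_distrib] at hsum ⊢
  have ha_sum := Finset.sum_nonneg ha₀
  have he_sum := Finset.sum_nonneg he₀
  have hy_sum := Finset.sum_nonneg hy₀
  have hexp : ∏ i ∈ W, Real.exp (logCorrection (2 * e i))
      ≤ Real.exp (9 / 8 * (∑ i ∈ W, e i + (∑ i ∈ W, y i) / 2)) := by
    rw [← Real.exp_sum, Real.exp_le_exp, Finset.sum_div, ← Finset.sum_add_distrib, Finset.mul_sum]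
    exact Finset.sum_le_sum fun i hi => logCorrection_le (he₀ i hi) (hy₀ i hi) (hy i hi) (he i hi)
  have hbias : ∑ i ∈ W, 4 * a i * e i ≤ ∑ i ∈ W, a i + (∑ i ∈ W, y i) / 3 := by
    rw [Finset.sum_div, ← Finset.sum_add_distrib]
    refine Finset.sum_le_sum fun i hi => ?_
    have hsq : a i * y i ^ 2 ≤ 1 / 2 * (y i * (1 / 6)) := by
      rw [sq]
      exact mul_le_mul (ha i hi) (mul_le_mul_of_nonneg_left (hy i hi) (hy₀ i hi))
        (mul_nonneg (hy₀ i hi) (hy₀ i hi)) (by norm_num)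
    nlinarith [mul_le_mul_of_nonneg_left (he i hi) (ha₀ i hi)]
  have hcorr := prod_add_prod_sub_prod_le_coshCorrection W (b := fun i => 2 * a i)
    (fun i hi => mul_nonneg (mul_nonneg zero_le_four (ha₀ i hi)) (he₀ i hi)) hbias
    (fun i hi => by linarith [ha₀ i hi]) (fun i hi => by linarith [ha i hi])
    (by rw [← Finset.mul_sum]; linarith)
  have hnonneg := coshCorrection_nonneg (u := ∑ i ∈ W, a i + (∑ i ∈ W, y i) / 3) (by positivity)
  calc _ ≤ _ := mul_le_mul_of_nonneg_left hcorr (Finset.prod_nonneg fun i _ => (Real.exp_pos _).le)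
    _ ≤ _ := mul_le_mul_of_nonneg_right hexp hnonneg
    _ ≤ _ := exp_mul_coshCorrection_le (by positivity) (by positivity) (by linarith)
    _ = _ := by ring

end CorrectionFactor

section NaiveBayesWeight

lemma abs_sub_half_le {q : ℝ} (hq : q ∈ Set.Icc 0 1) : |q - 1 / 2| ≤ 1 / 2 :=
  abs_le.2 ⟨by linarith [hq.1], by linarith [hq.2]⟩

lemma naiveBayesWeight_one : naiveBayesWeight 1 = ⊤ := by simp [naiveBayesWeight]

lemma naiveBayesWeight_zero : naiveBayesWeight 0 = ⊥ := by simp [naiveBayesWeight]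

lemma naiveBayesWeight_eq_logit {q : ℝ} (hq₀ : 0 < q) (hq₁ : q < 1) :
    naiveBayesWeight q = ((logit (q - 1 / 2) : ℝ) : EReal) := by
  rw [naiveBayesWeight, logit, ← ENNReal.ofReal_div_of_pos (by linarith),
    ENNReal.log_ofReal_of_pos (div_pos hq₀ (by linarith))]
  congr 3 <;> ring

lemma naiveBayesWeight_nonneg {q : ℝ} (hq : 1 / 2 ≤ q) : 0 ≤ naiveBayesWeight q := by
  rw [naiveBayesWeight, ← ENNReal.log_one]
  refine ENNReal.log_monotone ?_
  rw [ENNReal.le_div_iff_mul_le (by right; simp; linarith) (by simp), one_mul]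
  exact ENNReal.ofReal_le_ofReal (by linarith)

lemma naiveBayesWeight_nonpos {q : ℝ} (hq : q ≤ 1 / 2) : naiveBayesWeight q ≤ 0 := by
  rw [naiveBayesWeight, ← ENNReal.log_one]
  refine ENNReal.log_monotone (ENNReal.div_le_of_le_mul ?_)
  rw [one_mul]
  exact ENNReal.ofReal_le_ofReal (by linarith)

end NaiveBayesWeight

section VoteError

variable {ι : Type*} [Fintype ι]

/-- The total weight, possibly infinite, of the terms of `∑ i, x i * w i` that are positive. -/
noncomputable def supportWeight (w : ι → EReal) (x : ι → ℤˣ) : ENNReal :=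
  ∑ i, ((signVal (x i) : EReal) * w i).toENNReal

/-- The error of the weighted vote when the true state is positive, a tie counting one half. -/
noncomputable def voteErr (w : ι → EReal) (x : ι → ℤˣ) : ℝ :=
  if supportWeight w (-x) < supportWeight w x then 0
  else if supportWeight w x < supportWeight w (-x) then 1 else 1 / 2

lemma voteErr_mem_Icc (w : ι → EReal) (x : ι → ℤˣ) : voteErr w x ∈ Set.Icc 0 1 := by
  unfold voteErr
  split_ifs <;> norm_num

lemma voteErr_le_of_supportWeight_le {w : ι → EReal} {x y : ι → ℤˣ}
    (hpos : supportWeight w y ≤ supportWeight w x)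
    (hneg : supportWeight w (-x) ≤ supportWeight w (-y)) : voteErr w x ≤ voteErr w y := by
  by_cases hx : supportWeight w (-x) < supportWeight w x
  · rw [voteErr, if_pos hx]
    exact (voteErr_mem_Icc w y).1
  by_cases hy : supportWeight w y < supportWeight w (-y)
  · rw [voteErr.eq_def w y, if_neg hy.not_gt, if_pos hy]
    exact (voteErr_mem_Icc w x).2
  have hx' : ¬supportWeight w x < supportWeight w (-x) := fun h =>
    hy (hpos.trans_lt (h.trans_le hneg))
  have hy' : ¬supportWeight w (-y) < supportWeight w y := fun h =>
    hx (hneg.trans_lt (h.trans_le hpos))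
  rw [voteErr, voteErr, if_neg hx, if_neg hx', if_neg hy, if_neg hy']

lemma supportWeight_coe (w : ι → ℝ) (x : ι → ℤˣ) :
    supportWeight (fun i => (w i : EReal)) x = ENNReal.ofReal (∑ i, (w i * signVal (x i))⁺) := by
  rw [ENNReal.ofReal_sum_of_nonneg fun i _ => posPart_nonneg _]
  refine Finset.sum_congr rfl fun i _ => ?_
  rw [← EReal.coe_mul, EReal.toENNReal_of_ne_top (EReal.coe_ne_top _), EReal.toReal_coe, mul_comm,
    posPart_def, ENNReal.ofReal_max, ENNReal.ofReal_zero, max_eq_left zero_le]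

lemma voteErr_coe (w : ι → ℝ) (x : ι → ℤˣ) :
    voteErr (fun i => (w i : EReal)) x = scoreErr (∑ i, w i * signVal (x i)) := by
  have hscore : ∑ i, w i * signVal (x i)
      = ∑ i, (w i * signVal (x i))⁺ - ∑ i, (w i * signVal ((-x) i))⁺ := by
    rw [← Finset.sum_sub_distrib]
    refine Finset.sum_congr rfl fun i _ => ?_
    rw [Pi.neg_apply, signVal_neg, mul_neg, posPart_neg, posPart_sub_negPart]
  have hnonneg (y : ι → ℤˣ) : 0 ≤ ∑ i, (w i * signVal (y i))⁺ :=
    Finset.sum_nonneg fun i _ => posPart_nonneg _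
  simp only [voteErr, supportWeight_coe, hscore, ENNReal.ofReal_lt_ofReal_iff_of_nonneg (hnonneg _)]
  generalize ∑ i, (w i * signVal (x i))⁺ = a
  generalize ∑ i, (w i * signVal ((-x) i))⁺ = b
  unfold scoreErr
  rcases lt_trichotomy a b with h | rfl | h
  · simp [h.not_gt, h, sign_neg (sub_neg.2 h)]
  · simp
  · simp [h, sign_pos (sub_pos.2 h)]

/-- The error of the vote weighted according to the competences `q`, which are in general not those
of the voters. -/
noncomputable def naiveBayesErr (q : ι → ℝ) : (ι → ℤˣ) → ℝ :=
  voteErr fun i => naiveBayesWeight (q i)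

lemma naiveBayesErr_eq_scoreErr {q : ι → ℝ} (hq : ∀ i, q i ∈ Set.Ioo 0 1) (x : ι → ℤˣ) :
    naiveBayesErr q x = scoreErr (∑ i, logit (q i - 1 / 2) * signVal (x i)) := by
  rw [naiveBayesErr, ← voteErr_coe]
  congr 1
  exact funext fun i => naiveBayesWeight_eq_logit (hq i).1 (hq i).2

lemma supportWeight_eq_top {w : ι → EReal} {x : ι → ℤˣ} {k : ι}
    (hk : (signVal (x k) : EReal) * w k = ⊤) : supportWeight w x = ⊤ :=
  ENNReal.sum_eq_top.2 ⟨k, Finset.mem_univ k, by rw [hk, EReal.toENNReal_top]⟩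

lemma supportWeight_lt_top {w : ι → EReal} {x : ι → ℤˣ}
    (h : ∀ i, (signVal (x i) : EReal) * w i ≠ ⊤) : supportWeight w x < ⊤ :=
  ENNReal.sum_lt_top.2 fun i _ => (EReal.toENNReal_ne_top_iff.2 (h i)).lt_top

lemma voteErr_eq_zero_of_top {w : ι → EReal} {x : ι → ℤˣ} {k : ι}
    (hk : (signVal (x k) : EReal) * w k = ⊤) (h : ∀ i, (signVal (x i) : EReal) * w i ≠ ⊥) :
    voteErr w x = 0 := by
  rw [voteErr, supportWeight_eq_top hk, if_pos (supportWeight_lt_top fun i => ?_)]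
  rw [Pi.neg_apply, signVal_neg, EReal.coe_neg, EReal.neg_mul, Ne, EReal.neg_eq_top_iff]
  exact h i

lemma voteErr_of_card_eq_two (hcard : Fintype.card ι = 2) {w : ι → EReal}
    (hw : ∀ i j, w i = w j) {x : ι → ℤˣ} {i j : ι} (hx : x i ≠ x j) : voteErr w x = 1 / 2 := by
  classical
  have hij : i ≠ j := fun h => hx (by rw [h])
  have huniv : ({i, j} : Finset ι) = Finset.univ := by
    rw [← Finset.card_eq_iff_eq_univ, Finset.card_pair hij, hcard]
  have hj : x j = -x i := by
    rcases Int.units_eq_one_or (x i) with h | h <;>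
      rcases Int.units_eq_one_or (x j) with h' | h' <;> simp_all
  have htie : supportWeight w (-x) = supportWeight w x := by
    rw [supportWeight, supportWeight, ← huniv, Finset.sum_pair hij, Finset.sum_pair hij, hw j i,
      Pi.neg_apply, Pi.neg_apply, hj, neg_neg, add_comm]
  simp [voteErr, htie]

variable [DecidableEq ι]

/-- Infinite weights have the sign of an infallible expert, who is almost surely right. -/
lemma signMean_naiveBayesErr_eq_zero {m q : ι → ℝ} (hq : ∀ i, q i ∈ Set.Icc 0 1)
    (hm : ∀ i, q i = 0 ∨ q i = 1 → m i = q i - 1 / 2) (hex : ∃ i, q i = 0 ∨ q i = 1) :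
    signMean m (naiveBayesErr q) = 0 := by
  refine Finset.sum_eq_zero fun x _ => mul_eq_zero.2 ?_
  by_contra! h
  have hmass (i : ι) : 1 / 2 + m i * signVal (x i) ≠ 0 :=
    Finset.prod_ne_zero_iff.1 h.1 i (Finset.mem_univ i)
  have htop (i : ι) (hi : q i = 0 ∨ q i = 1) :
      (signVal (x i) : EReal) * naiveBayesWeight (q i) = ⊤ := by
    have := hmass i
    rw [hm i hi] at this
    rcases hi with hi | hi <;> rcases signVal_eq_one_or (x i) with hs | hs <;>
      rw [hi, hs] at this <;> norm_num at this <;> rw [hi, hs]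
    · simp [naiveBayesWeight_zero]
    · simp [naiveBayesWeight_one]
  obtain ⟨k, hk⟩ := hex
  refine h.2 (voteErr_eq_zero_of_top (htop k hk) fun i => ?_)
  by_cases hi : q i = 0 ∨ q i = 1
  · simp [htop i hi]
  · push Not at hi
    rw [naiveBayesWeight_eq_logit ((hq i).1.lt_of_ne' hi.1) ((hq i).2.lt_of_ne hi.2),
      ← EReal.coe_mul]
    exact EReal.coe_ne_bot _

lemma voteErr_le_voteErr_flipAt {w : ι → EReal} {k : ι} {x : ι → ℤˣ}
    (h : 0 ≤ (signVal (x k) : EReal) * w k) : voteErr w x ≤ voteErr w (flipAt k x) := by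
  have hk : -((signVal (x k) : EReal) * w k) ≤ (signVal (x k) : EReal) * w k :=
    (EReal.neg_le.1 (by rwa [neg_zero])).trans h
  refine voteErr_le_of_supportWeight_le ?_ ?_ <;>
    refine Finset.sum_le_sum fun i _ => EReal.toENNReal_le_toENNReal ?_
  all_goals
    by_cases hi : i = k
    · subst hi
      simpa [EReal.neg_mul] using hk
    · simp [flipAt_of_ne hi]

lemma signVal_mul_voteErr_sub_mem_of_nonneg {w : ι → EReal} {k : ι} (hw : 0 ≤ w k) (x : ι → ℤˣ) :
    signVal (x k) * (voteErr w x - voteErr w (flipAt k x)) ∈ Set.Icc (-1) 0 := by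
  obtain ⟨hx₀, hx₁⟩ := voteErr_mem_Icc w x
  obtain ⟨hf₀, hf₁⟩ := voteErr_mem_Icc w (flipAt k x)
  rcases signVal_eq_one_or (x k) with h | h
  · have := voteErr_le_voteErr_flipAt (w := w) (k := k) (x := x) (by simpa [h] using hw)
    constructor <;> rw [h] <;> linarith
  · have := voteErr_le_voteErr_flipAt (w := w) (k := k) (x := flipAt k x) (by simpa [h] using hw)
    rw [flipAt_flipAt] at this
    constructor <;> rw [h] <;> linarith

lemma signVal_mul_voteErr_sub_mem_of_nonpos {w : ι → EReal} {k : ι} (hw : w k ≤ 0) (x : ι → ℤˣ) :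
    signVal (x k) * (voteErr w x - voteErr w (flipAt k x)) ∈ Set.Icc 0 1 := by
  obtain ⟨hx₀, hx₁⟩ := voteErr_mem_Icc w x
  obtain ⟨hf₀, hf₁⟩ := voteErr_mem_Icc w (flipAt k x)
  have hneg : 0 ≤ -w k := EReal.neg_nonneg.2 hw
  rcases signVal_eq_one_or (x k) with h | h
  · have := voteErr_le_voteErr_flipAt (w := w) (k := k) (x := flipAt k x)
      (by simpa [h] using hneg)
    rw [flipAt_flipAt] at this
    constructor <;> rw [h] <;> linarith
  · have := voteErr_le_voteErr_flipAt (w := w) (k := k) (x := x) (by simpa [h] using hneg)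
    constructor <;> rw [h] <;> linarith

end VoteError

section Coupling

variable {ι : Type*} [Fintype ι] [DecidableEq ι]

lemma signMean_voteErr_le_one {m : ι → ℝ} (hm : ∀ i, |m i| ≤ 1 / 2) (w : ι → EReal) :
    signMean m (voteErr w) ≤ 1 :=
  (signMean_mono hm fun x _ => (voteErr_mem_Icc w x).2).trans_eq (signMean_const m 1)

lemma signMean_le_piecewise_add_sum {m e D : ι → ℝ} (hm : ∀ i, |m i| ≤ 1 / 2)
    (he : ∀ i, |e i| ≤ 1 / 2) {F : (ι → ℤˣ) → ℝ} (S : Finset ι)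
    (h : ∀ i ∈ S, ∀ n : ι → ℝ, (∀ k, |n k| ≤ 1 / 2) → n i = m i →
      signMean n F ≤ signMean (Function.update n i (e i)) F + D i) :
    signMean m F ≤ signMean (S.piecewise e m) F + ∑ i ∈ S, D i := by
  induction S using Finset.induction_on with
  | empty => simp
  | insert i S hi ih =>
    have hS := ih fun j hj => h j (Finset.mem_insert_of_mem hj)
    have hmixed (k : ι) : |S.piecewise e m k| ≤ 1 / 2 :=
      S.piecewise_cases e m (fun a => |a| ≤ 1 / 2) (he k) (hm k)
    have hstep := h i (Finset.mem_insert_self i S) _ hmixed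
      (Finset.piecewise_eq_of_notMem _ _ _ hi)
    rw [Finset.piecewise_insert, Finset.sum_insert hi]
    linarith

/-- The cost of replacing the bias `a` of a voter by `e`, if the sign of its weight is that of `e`:
only a move in the favourable direction decreases the error. -/
noncomputable def switchCost (a e : ℝ) : ℝ := max (|e| - (SignType.sign e : ℝ) * a) 0

lemma signMean_naiveBayesErr_le_update {m : ι → ℝ} (q : ι → ℝ) (hm : ∀ k, |m k| ≤ 1 / 2) (i : ι) :
    signMean m (naiveBayesErr q)
      ≤ signMean (Function.update m i (q i - 1 / 2)) (naiveBayesErr q)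
        + switchCost (m i) (q i - 1 / 2) := by
  have hpos (h : 0 ≤ q i - 1 / 2) := signVal_mul_voteErr_sub_mem_of_nonneg
    (w := fun i => naiveBayesWeight (q i)) (naiveBayesWeight_nonneg (by linarith : 1 / 2 ≤ q i))
  have hneg (h : q i - 1 / 2 ≤ 0) := signVal_mul_voteErr_sub_mem_of_nonpos
    (w := fun i => naiveBayesWeight (q i)) (naiveBayesWeight_nonpos (by linarith : q i ≤ 1 / 2))
  have hmul {c β : ℝ} (hβ₀ : 0 ≤ β) (hβ₁ : β ≤ 1) : c * β ≤ max c 0 :=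
    (mul_le_mul_of_nonneg_right (le_max_left c 0) hβ₀).trans
      (mul_le_of_le_one_right (le_max_right c 0) hβ₁)
  unfold switchCost
  rcases lt_trichotomy (q i - 1 / 2) 0 with he | he | he
  · obtain ⟨β, ⟨hβ₀, hβ₁⟩, heq⟩ := exists_signMean_eq_update_add i hm (q i - 1 / 2) (hneg he.le)
    rw [naiveBayesErr, heq, abs_of_neg he, sign_neg he, SignType.coe_neg_one, neg_one_mul,
      neg_sub_neg]
    exact add_le_add_right (hmul hβ₀ hβ₁) _
  · obtain ⟨β, ⟨hβ₀, hβ₁⟩, heq⟩ := exists_signMean_eq_update_add (lo := 0) (hi := 0) i hm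
      (q i - 1 / 2) fun x => ⟨(hneg he.le x).1, (hpos he.ge x).2⟩
    rw [naiveBayesErr, heq, le_antisymm hβ₁ hβ₀, mul_zero]
    exact add_le_add_right (le_max_right _ _) _
  · obtain ⟨β, ⟨hβ₀, hβ₁⟩, heq⟩ := exists_signMean_eq_update_add i hm (q i - 1 / 2) (hpos he.le)
    rw [naiveBayesErr, heq, abs_of_pos he, sign_pos he, SignType.coe_one, one_mul,
      ← neg_mul_neg, neg_sub]
    exact add_le_add_right (hmul (by linarith) (by linarith)) _

lemma abs_voteErr_sub_le_of_card_eq_two (hcard : Fintype.card ι = 2) {w : ι → EReal}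
    (hw : ∀ i j, w i = w j) (i : ι) (x : ι → ℤˣ) :
    |voteErr w x - voteErr w (flipAt i x)| ≤ 1 / 2 := by
  have : Nontrivial ι := Fintype.one_lt_card_iff_nontrivial.1 (by omega)
  obtain ⟨j, hj⟩ := exists_ne i
  obtain ⟨hx₀, hx₁⟩ := voteErr_mem_Icc w x
  obtain ⟨hf₀, hf₁⟩ := voteErr_mem_Icc w (flipAt i x)
  rw [abs_le]
  by_cases hx : x i = x j
  · have htie : voteErr w (flipAt i x) = 1 / 2 := by
      refine voteErr_of_card_eq_two hcard hw (i := i) (j := j) ?_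
      rw [flipAt_same, flipAt_of_ne hj, hx]
      exact neg_units_ne_self (x j)
    constructor <;> linarith
  · rw [voteErr_of_card_eq_two hcard hw hx]
    constructor <;> linarith

lemma signMean_naiveBayesErr_le_update_of_card_eq_two (hcard : Fintype.card ι = 2) {m q : ι → ℝ}
    (hm : ∀ k, |m k| ≤ 1 / 2) (hq : ∀ i j, q i = q j) (i : ι) :
    signMean m (naiveBayesErr q)
      ≤ signMean (Function.update m i (q i - 1 / 2)) (naiveBayesErr q)
        + 1 / 2 * |m i - (q i - 1 / 2)| := by
  have hinfluence (x : ι → ℤˣ) :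
      signVal (x i) * (naiveBayesErr q x - naiveBayesErr q (flipAt i x))
        ∈ Set.Icc (-(1 / 2) : ℝ) (1 / 2) := by
    have := abs_voteErr_sub_le_of_card_eq_two hcard
      (w := fun i => naiveBayesWeight (q i)) (fun j k => by rw [hq j k]) i x
    rw [Set.mem_Icc, ← abs_le, abs_mul]
    rcases signVal_eq_one_or (x i) with h | h <;> rw [h] <;> simpa [naiveBayesErr] using this
  obtain ⟨β, hβ, heq⟩ := exists_signMean_eq_update_add i hm (q i - 1 / 2) hinfluence
  rw [heq]
  refine add_le_add_right ((le_abs_self _).trans ?_) _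
  rw [abs_mul, mul_comm]
  exact mul_le_mul_of_nonneg_right (abs_le.2 hβ) (abs_nonneg _)

/-- The charge for a deviation `r` of the empirical pseudo competence of a voter of bias `a`: a
deviation against the bias counts twice. -/
noncomputable def deviationCost (a r : ℝ) : ℝ := (3 * |r| - if 0 ≤ a then r else -r) / 2

lemma abs_le_deviationCost (a r : ℝ) : |r| ≤ deviationCost a r := by
  unfold deviationCost
  split_ifs <;> linarith [le_abs_self r, neg_abs_le r]

lemma deviationCost_nonneg (a r : ℝ) : 0 ≤ deviationCost a r :=
  (abs_nonneg r).trans (abs_le_deviationCost a r)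

lemma deviationCost_of_mul_neg {a e : ℝ} (g : ℝ) (h : a * e < 0) :
    deviationCost a (e - 2 * a * g)
      = (3 * |(|e| + 2 * |a| * g)| + (|e| + 2 * |a| * g)) / 2 := by
  unfold deviationCost
  rcases mul_neg_iff.1 h with ⟨ha, he⟩ | ⟨ha, he⟩
  · rw [if_pos ha.le, abs_of_pos ha, abs_of_neg he, ← abs_neg]
    ring_nf
  · rw [if_neg ha.not_ge, abs_of_neg ha, abs_of_pos he]
    ring_nf

lemma switchCost_of_mul_neg {a e : ℝ} (h : a * e < 0) : switchCost a e = |a| + |e| := by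
  unfold switchCost
  rcases mul_neg_iff.1 h with ⟨ha, he⟩ | ⟨ha, he⟩
  · rw [abs_of_pos ha, abs_of_neg he, sign_neg he, SignType.coe_neg_one, max_eq_left (by linarith)]
    ring
  · rw [abs_of_neg ha, abs_of_pos he, sign_pos he, SignType.coe_one, max_eq_left (by linarith)]
    ring

lemma switchCost_le_deviationCost {a e g : ℝ} (hg : g ≤ 1 / 2) (h : 0 ≤ a * e) :
    switchCost a e ≤ deviationCost a (e - 2 * a * g) := by
  refine max_le ((?_ : _ ≤ |e - 2 * a * g|).trans (abs_le_deviationCost _ _))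
    (deviationCost_nonneg _ _)
  rcases lt_trichotomy e 0 with he | he | he
  · have ha : a ≤ 0 := nonpos_of_mul_nonneg_left h he
    rw [abs_of_neg he, sign_neg he, SignType.coe_neg_one]
    nlinarith [neg_abs_le (e - 2 * a * g)]
  · rw [he, abs_zero, sign_zero, SignType.coe_zero, zero_mul, sub_zero]
    exact abs_nonneg _
  · have ha : 0 ≤ a := nonneg_of_mul_nonneg_left h he
    rw [abs_of_pos he, sign_pos he, SignType.coe_one]
    nlinarith [le_abs_self (e - 2 * a * g)]

lemma signMean_naiveBayesErr_le_exp_mul (W : Finset ι) {m q : ι → ℝ} (hm : ∀ i, |m i| ≤ 1 / 2)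
    (hq : ∀ i, q i ∈ Set.Ioo 0 1) (hmq : ∀ i ∉ W, m i = q i - 1 / 2)
    (hW : ∀ i ∈ W, m i * (q i - 1 / 2) ≤ 0) :
    signMean m (naiveBayesErr q) ≤
      1 / 2 * Real.exp (-(∑ i, (q i - 1 / 2) * logit (q i - 1 / 2)) / 2) *
        correctionFactor W (fun i => |m i|) (fun i => |q i - 1 / 2|) := by
  have he (i : ι) : |q i - 1 / 2| < 1 / 2 :=
    abs_lt.2 ⟨by linarith [(hq i).1], by linarith [(hq i).2]⟩
  have hscore := signMean_scoreErr_le W hm he hmq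
  simp only [← naiveBayesErr_eq_scoreErr hq] at hscore
  refine hscore.trans ?_
  have hmul (i : ι) (hi : i ∈ W) : 4 * m i * (q i - 1 / 2) = -(4 * |m i| * |q i - 1 / 2|) := by
    rw [mul_assoc, mul_assoc, ← abs_mul, abs_of_nonpos (hW i hi)]
    ring
  have hadd : ∏ i ∈ W, (1 + 4 * m i * (q i - 1 / 2)) = ∏ i ∈ W, (1 - 4 * |m i| * |q i - 1 / 2|) :=
    Finset.prod_congr rfl fun i hi => by rw [hmul i hi, ← sub_eq_add_neg]
  have hsub : ∏ i ∈ W, (1 - 4 * m i * (q i - 1 / 2)) = ∏ i ∈ W, (1 + 4 * |m i| * |q i - 1 / 2|) :=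
    Finset.prod_congr rfl fun i hi => by rw [hmul i hi, sub_neg_eq_add]
  rw [hadd, hsub, Finset.prod_congr rfl fun i (_ : i ∈ W) => inv_sqrt_one_sub (he i),
    Finset.prod_mul_distrib]
  have hsqrt : (∏ i ∈ Wᶜ, √(1 - 4 * (q i - 1 / 2) ^ 2)) *
      ∏ i ∈ W, Real.exp (-((q i - 1 / 2) * logit (q i - 1 / 2)) / 2)
      ≤ Real.exp (-(∑ i, (q i - 1 / 2) * logit (q i - 1 / 2)) / 2) := by
    rw [← Finset.sum_neg_distrib, Finset.sum_div, Real.exp_sum, ← Finset.prod_compl_mul_prod W]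
    gcongr with i
    exact sqrt_one_sub_le_exp (he i)
  have hfactor := correctionFactor_nonneg W (fun i _ => abs_nonneg (m i)) (fun i _ => hm i)
    (fun i _ => abs_nonneg (q i - 1 / 2)) (fun i _ => (he i).le)
  refine le_of_eq_of_le ?_ (mul_le_mul_of_nonneg_right
    (mul_le_mul_of_nonneg_left hsqrt one_half_pos.le) hfactor)
  rw [correctionFactor]
  ring

lemma signMean_naiveBayesErr_le_correctionFactor (W : Finset ι) {m q : ι → ℝ} {δ : ℝ}
    (hm : ∀ i, |m i| ≤ 1 / 2) (hq : ∀ i, q i ∈ Set.Icc 0 1) (hmq : ∀ i ∉ W, m i = q i - 1 / 2)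
    (hWq : ∀ i ∈ W, q i ∈ Set.Ioo 0 1) (hW : ∀ i ∈ W, m i * (q i - 1 / 2) ≤ 0) (hδ : 0 ≤ δ)
    (hR : (∀ i, q i ∈ Set.Ioo 0 1) →
      Real.exp (-(∑ i, (q i - 1 / 2) * logit (q i - 1 / 2)) / 2) ≤ δ / 2) :
    signMean m (naiveBayesErr q)
      ≤ δ / 4 * correctionFactor W (fun i => |m i|) (fun i => |q i - 1 / 2|) := by
  have hfactor := correctionFactor_nonneg W (fun i _ => abs_nonneg (m i)) (fun i _ => hm i)
    (fun i _ => abs_nonneg (q i - 1 / 2)) (fun i _ => abs_sub_half_le (hq i))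
  by_cases hex : ∃ i, q i = 0 ∨ q i = 1
  · rw [signMean_naiveBayesErr_eq_zero hq (fun i hi => hmq i fun hiW => ?_) hex]
    · positivity
    · exact hi.elim (hWq i hiW).1.ne' (hWq i hiW).2.ne
  · push Not at hex
    have hq' (i : ι) : q i ∈ Set.Ioo 0 1 :=
      ⟨(hq i).1.lt_of_ne' (hex i).1, (hq i).2.lt_of_ne (hex i).2⟩
    refine (signMean_naiveBayesErr_le_exp_mul W hm hq' hmq hW).trans ?_
    exact mul_le_mul_of_nonneg_right (by linarith [hR hq']) hfactor

end Coupling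

section ErrorBound

variable {ι : Type*} [Fintype ι] [DecidableEq ι]

lemma le_quarter_add_sq {a e g s z : ℝ} (ha : 0 ≤ a) (he : e + 2 * a * g ≤ z) (hz : s + 2 * z ≤ 1)
    (hg : 0 ≤ g ∨ a - 2 * g ≤ s) : e ≤ 1 / 4 + z ^ 2 := by
  by_cases hg₀ : 0 ≤ g
  · nlinarith [mul_nonneg ha hg₀, sq_nonneg (z - 1 / 2)]
  · have hs := hg.resolve_left hg₀
    have hamgm : a * (s - a) ≤ s ^ 2 / 4 := by nlinarith [sq_nonneg (s - 2 * a)]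
    have hsq : s ^ 2 ≤ (1 - 2 * z) ^ 2 :=
      pow_le_pow_left₀ (by linarith [not_le.1 hg₀]) (by linarith) 2
    nlinarith [mul_le_mul_of_nonneg_left (by linarith : -(2 * g) ≤ s - a) ha]

lemma switchCost_le_add_deviationCost {a e g : ℝ} (hg : g ≤ 1 / 2)
    (h : 0 ≤ a * e ∨ |a| * (1 - 2 * g) ≤ 4 * (|e| + 2 * |a| * g)) :
    switchCost a e ≤ 3 / 4 * (|a| * (1 - 2 * g)) + deviationCost a (e - 2 * a * g) := by
  have hdefect : 0 ≤ |a| * (1 - 2 * g) := mul_nonneg (abs_nonneg a) (by linarith)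
  by_cases hae : 0 ≤ a * e
  · linarith [switchCost_le_deviationCost hg hae]
  · have hae' := not_le.1 hae
    have := h.resolve_left hae
    have hy : 0 ≤ |e| + 2 * |a| * g := by linarith
    rw [switchCost_of_mul_neg hae', deviationCost_of_mul_neg g hae', abs_of_nonneg hy]
    linarith

lemma two_mul_max_le_deviationCost {a e : ℝ} (g : ℝ) (h : a * e < 0) :
    2 * max (|e| + 2 * |a| * g) 0 ≤ deviationCost a (e - 2 * a * g) := by
  rw [deviationCost_of_mul_neg g h]
  rcases le_total (|e| + 2 * |a| * g) 0 with hy | hy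
  · rw [max_eq_right hy, abs_of_nonpos hy]
    linarith
  · rw [max_eq_left hy, abs_of_nonneg hy]
    linarith

lemma peerBias_nonneg_or_sub_le_sum_competenceDefect (hcard : Fintype.card ι ≠ 2) {m : ι → ℝ}
    (hm : ∀ i, |m i| ≤ 1 / 2) (i : ι) :
    0 ≤ peerBias m i ∨ |m i| - 2 * peerBias m i ≤ ∑ k, competenceDefect m k := by
  by_cases hcard₃ : 3 ≤ Fintype.card ι
  · exact Or.inr (sub_le_sum_competenceDefect hcard₃ hm i)
  · have hpos : 0 < Fintype.card ι := Fintype.card_pos_iff.2 ⟨i⟩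
    have hpeers : (Finset.univ.erase i : Finset ι) = ∅ := by
      rw [← Finset.card_eq_zero, Finset.card_erase_of_mem (Finset.mem_univ i), Finset.card_univ]
      omega
    left
    simp [peerBias, peerSign, peerSum, hpeers, signMean]

/-- The cost of the deviation of the estimate `q i` from the pseudo competence
`1 / 2 + 2 * m i * peerBias m i` of the voter `i`. -/
noncomputable def voterDeviationCost (m q : ι → ℝ) (i : ι) : ℝ :=
  deviationCost (m i) (q i - 1 / 2 - 2 * m i * peerBias m i)

lemma voterDeviationCost_nonneg (m q : ι → ℝ) (i : ι) : 0 ≤ voterDeviationCost m q i :=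
  deviationCost_nonneg _ _

/-- The voters whose weight has the wrong sign although their estimate deviates little from their
pseudo competence. They are too costly to switch, and stay at their bias. -/
noncomputable def reversedVoters (m q : ι → ℝ) : Finset ι :=
  {i | m i * (q i - 1 / 2) < 0 ∧
    4 * (|q i - 1 / 2| + 2 * |m i| * peerBias m i) < competenceDefect m i}

lemma switchCost_le_of_notMem_reversedVoters {m : ι → ℝ} (hm : ∀ i, |m i| ≤ 1 / 2) (q : ι → ℝ)
    {i : ι} (hi : i ∉ reversedVoters m q) :
    switchCost (m i) (q i - 1 / 2)
      ≤ 3 / 4 * competenceDefect m i + voterDeviationCost m q i := by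
  refine switchCost_le_add_deviationCost (abs_le.1 (abs_peerBias_le hm i)).2 ?_
  simpa [reversedVoters, competenceDefect, imp_iff_not_or] using hi

lemma sum_competenceDefect_add_two_mul_max_le_one {m q : ι → ℝ}
    (hsmall : ∑ i, competenceDefect m i + ∑ i, voterDeviationCost m q i ≤ 1) {i : ι}
    (hi : i ∈ reversedVoters m q) :
    ∑ k, competenceDefect m k + 2 * max (|q i - 1 / 2| + 2 * |m i| * peerBias m i) 0 ≤ 1 := by
  have hcost := two_mul_max_le_deviationCost (peerBias m i) (Finset.mem_filter.1 hi).2.1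
  have := Finset.single_le_sum (fun k _ => voterDeviationCost_nonneg m q k) (Finset.mem_univ i)
  rw [voterDeviationCost] at this
  linarith

lemma max_le_sixth_of_mem_reversedVoters {m q : ι → ℝ} (hm : ∀ i, |m i| ≤ 1 / 2)
    (hsmall : ∑ i, competenceDefect m i + ∑ i, voterDeviationCost m q i ≤ 1) {i : ι}
    (hi : i ∈ reversedVoters m q) :
    max (|q i - 1 / 2| + 2 * |m i| * peerBias m i) 0 ≤ 1 / 6 := by
  have hsum := sum_competenceDefect_add_two_mul_max_le_one hsmall hi
  have hdefect := Finset.single_le_sum (fun k _ => competenceDefect_nonneg hm k)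
    (Finset.mem_univ i)
  refine max_le ?_ (by norm_num)
  linarith [(Finset.mem_filter.1 hi).2.2,
    le_max_left (|q i - 1 / 2| + 2 * |m i| * peerBias m i) 0]

lemma abs_sub_half_le_of_mem_reversedVoters (hcard : Fintype.card ι ≠ 2) {m q : ι → ℝ}
    (hm : ∀ i, |m i| ≤ 1 / 2)
    (hsmall : ∑ i, competenceDefect m i + ∑ i, voterDeviationCost m q i ≤ 1) {i : ι}
    (hi : i ∈ reversedVoters m q) :
    |q i - 1 / 2| ≤ 1 / 4 + max (|q i - 1 / 2| + 2 * |m i| * peerBias m i) 0 ^ 2 :=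
  le_quarter_add_sq (abs_nonneg _) (le_max_left _ _)
    (sum_competenceDefect_add_two_mul_max_le_one hsmall hi)
    (peerBias_nonneg_or_sub_le_sum_competenceDefect hcard hm i)

lemma mem_Ioo_of_mem_reversedVoters (hcard : Fintype.card ι ≠ 2) {m q : ι → ℝ}
    (hm : ∀ i, |m i| ≤ 1 / 2)
    (hsmall : ∑ i, competenceDefect m i + ∑ i, voterDeviationCost m q i ≤ 1) {i : ι}
    (hi : i ∈ reversedVoters m q) : q i ∈ Set.Ioo 0 1 := by
  have hquarter := abs_sub_half_le_of_mem_reversedVoters hcard hm hsmall hi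
  have hsixth := max_le_sixth_of_mem_reversedVoters hm hsmall hi
  have hz := le_max_right (|q i - 1 / 2| + 2 * |m i| * peerBias m i) 0
  have := abs_lt.1 (by nlinarith : |q i - 1 / 2| < 1 / 2)
  constructor <;> linarith

lemma correctionFactor_reversedVoters_le (hcard : Fintype.card ι ≠ 2) {m q : ι → ℝ}
    (hm : ∀ i, |m i| ≤ 1 / 2)
    (hsmall : ∑ i, competenceDefect m i + ∑ i, voterDeviationCost m q i ≤ 1) :
    correctionFactor (reversedVoters m q) (fun i => |m i|) (fun i => |q i - 1 / 2|)
      ≤ 1 + 3 * ∑ i ∈ reversedVoters m q, competenceDefect m i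
        + 4 * ∑ i ∈ reversedVoters m q, voterDeviationCost m q i := by
  set W := reversedVoters m q
  set y : ι → ℝ := fun i => |q i - 1 / 2| + 2 * |m i| * peerBias m i with hy
  have hsplit (i : ι) : |m i| + |q i - 1 / 2| = competenceDefect m i + y i := by
    rw [hy, competenceDefect]
    ring
  have hcost (i : ι) (hi : i ∈ W) : 2 * max (y i) 0 ≤ voterDeviationCost m q i :=
    two_mul_max_le_deviationCost _ (Finset.mem_filter.1 hi).2.1
  have hsum : ∑ i ∈ W, (|m i| + |q i - 1 / 2|) + 5 / 6 * ∑ i ∈ W, max (y i) 0 ≤ 1 := by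
    refine le_trans ?_ hsmall
    rw [Finset.mul_sum, ← Finset.sum_add_distrib, ← Finset.sum_add_distrib]
    refine (Finset.sum_le_sum fun i hi => ?_).trans (Finset.sum_le_univ_sum_of_nonneg fun i =>
      add_nonneg (competenceDefect_nonneg hm i) (voterDeviationCost_nonneg m q i))
    linarith [hsplit i, hcost i hi, le_max_left (y i) 0, le_max_right (y i) 0]
  refine (correctionFactor_le W (fun i _ => abs_nonneg _) (fun i _ => hm i)
    (fun i _ => abs_nonneg _) (fun i _ => le_max_right _ _)
    (fun i hi => max_le_sixth_of_mem_reversedVoters hm hsmall hi)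
    (fun i hi => abs_sub_half_le_of_mem_reversedVoters hcard hm hsmall hi) hsum).trans ?_
  simp only [add_assoc, add_le_add_iff_left, Finset.mul_sum, ← Finset.sum_add_distrib]
  refine Finset.sum_le_sum fun i hi => ?_
  linarith [hsplit i, hcost i hi, le_max_left (y i) 0, le_max_right (y i) 0]

lemma signMean_naiveBayesErr_le_of_card_eq_two (hcard : Fintype.card ι = 2) {m q : ι → ℝ}
    (hm : ∀ i, |m i| ≤ 1 / 2) (hq : ∀ i, q i ∈ Set.Icc 0 1) (hqq : ∀ i j, q i = q j) :
    signMean m (naiveBayesErr q)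
      ≤ signMean (fun i => q i - 1 / 2) (naiveBayesErr q)
        + 1 / 2 * (∑ i, competenceDefect m i + ∑ i, voterDeviationCost m q i) := by
  have hswitch := signMean_le_piecewise_add_sum (e := fun i => q i - 1 / 2)
    (D := fun i => 1 / 2 * |m i - (q i - 1 / 2)|) hm
    (fun i => abs_sub_half_le (hq i)) Finset.univ fun i _ n hn hni => by
      rw [← hni]
      exact signMean_naiveBayesErr_le_update_of_card_eq_two hcard hn hqq i
  rw [Finset.piecewise_univ] at hswitch
  refine hswitch.trans (add_le_add_right ?_ _)
  rw [← Finset.mul_sum, ← Finset.sum_add_distrib]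
  refine mul_le_mul_of_nonneg_left (Finset.sum_le_sum fun i _ => ?_) (by norm_num)
  have hg := (abs_le.1 (abs_peerBias_le hm i)).2
  calc |m i - (q i - 1 / 2)|
      ≤ |m i - 2 * m i * peerBias m i| + |q i - 1 / 2 - 2 * m i * peerBias m i| := by
        rw [abs_sub_comm (q i - 1 / 2)]
        exact abs_sub_le _ _ _
    _ ≤ competenceDefect m i + voterDeviationCost m q i := by
        refine add_le_add (le_of_eq ?_) (abs_le_deviationCost _ _)
        rw [competenceDefect, ← abs_of_nonneg (by linarith : 0 ≤ 1 - 2 * peerBias m i), ← abs_mul]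
        ring_nf

lemma signMean_naiveBayesErr_le_of_card_ne_two (hcard : Fintype.card ι ≠ 2) {m q : ι → ℝ} {δ : ℝ}
    (hm : ∀ i, |m i| ≤ 1 / 2) (hq : ∀ i, q i ∈ Set.Icc 0 1) (hδ₀ : 0 ≤ δ) (hδ : δ ≤ 1)
    (hsmall : ∑ i, competenceDefect m i + ∑ i, voterDeviationCost m q i ≤ 1)
    (hR : (∀ i, q i ∈ Set.Ioo 0 1) →
      Real.exp (-(∑ i, (q i - 1 / 2) * logit (q i - 1 / 2)) / 2) ≤ δ / 2) :
    signMean m (naiveBayesErr q)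
      ≤ δ / 4 + 3 / 4 * ∑ i, competenceDefect m i + ∑ i, voterDeviationCost m q i := by
  set W := reversedVoters m q
  set e : ι → ℝ := fun i => q i - 1 / 2
  have he (i : ι) : |e i| ≤ 1 / 2 := abs_sub_half_le (hq i)
  have hmixed (i : ι) (hi : i ∈ W) : Wᶜ.piecewise e m i = m i := by simp [hi]
  have hswitch : signMean m (naiveBayesErr q) ≤ signMean (Wᶜ.piecewise e m) (naiveBayesErr q)
      + ∑ i ∈ Wᶜ, (3 / 4 * competenceDefect m i + voterDeviationCost m q i) :=
    signMean_le_piecewise_add_sum hm he Wᶜ fun i hi n hn hni =>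
      (signMean_naiveBayesErr_le_update q hn i).trans (add_le_add_right (hni ▸
        switchCost_le_of_notMem_reversedVoters hm q (Finset.mem_compl.1 hi)) _)
  have hstay := signMean_naiveBayesErr_le_correctionFactor W (m := Wᶜ.piecewise e m)
    (fun i => Wᶜ.piecewise_cases e m (fun a => |a| ≤ 1 / 2) (he i) (hm i)) hq
    (fun i hi => Finset.piecewise_eq_of_mem _ _ _ (Finset.mem_compl.2 hi))
    (fun i hi => mem_Ioo_of_mem_reversedVoters hcard hm hsmall hi)
    (fun i hi => by rw [hmixed i hi]; exact (Finset.mem_filter.1 hi).2.1.le) hδ₀ hR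
  rw [correctionFactor_congr_left W _ fun i hi => congrArg _ (hmixed i hi)] at hstay
  have hfactor := correctionFactor_reversedVoters_le hcard hm hsmall
  have hW : δ / 4 * correctionFactor W (fun i => |m i|) (fun i => |q i - 1 / 2|)
      ≤ δ / 4 + ∑ i ∈ W, (3 / 4 * competenceDefect m i + voterDeviationCost m q i) := by
    have hdefect := Finset.sum_nonneg fun i (_ : i ∈ W) => competenceDefect_nonneg hm i
    have hcost := Finset.sum_nonneg fun i (_ : i ∈ W) => voterDeviationCost_nonneg m q i
    rw [Finset.sum_add_distrib, ← Finset.mul_sum]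
    nlinarith
  rw [add_assoc, Finset.mul_sum, ← Finset.sum_add_distrib, ← Finset.sum_add_sum_compl W]
  linarith

theorem signMean_naiveBayesErr_le {m q : ι → ℝ} {δ : ℝ} (hm : ∀ i, |m i| ≤ 1 / 2)
    (hq : ∀ i, q i ∈ Set.Icc 0 1) (hqq : Fintype.card ι = 2 → ∀ i j, q i = q j) (hδ : δ ≤ 1)
    (hdefect : ∑ i, competenceDefect m i ≤ δ)
    (hR : (∀ i, q i ∈ Set.Ioo 0 1) →
      Real.exp (-(∑ i, (q i - 1 / 2) * logit (q i - 1 / 2)) / 2) ≤ δ / 2) :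
    signMean m (naiveBayesErr q)
      ≤ δ / 4 + 3 / 4 * ∑ i, competenceDefect m i + ∑ i, voterDeviationCost m q i := by
  have hdefect₀ := Finset.sum_nonneg fun i (_ : i ∈ Finset.univ) => competenceDefect_nonneg hm i
  have hcost₀ := Finset.sum_nonneg fun i (_ : i ∈ Finset.univ) => voterDeviationCost_nonneg m q i
  have hδ₀ := hdefect₀.trans hdefect
  by_cases hcard : Fintype.card ι = 2
  · have hideal := signMean_naiveBayesErr_le_correctionFactor ∅ (m := fun i => q i - 1 / 2)
      (fun i => abs_sub_half_le (hq i)) hq (fun i _ => rfl)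
      (by simp) (by simp) hδ₀ hR
    have := signMean_naiveBayesErr_le_of_card_eq_two hcard hm hq (hqq hcard)
    simp only [correctionFactor, Finset.prod_empty] at hideal
    linarith
  · by_cases hsmall : ∑ i, competenceDefect m i + ∑ i, voterDeviationCost m q i ≤ 1
    · exact signMean_naiveBayesErr_le_of_card_ne_two hcard hm hq hδ₀ hδ hsmall hR
    · refine (signMean_voteErr_le_one hm _).trans ?_
      linarith

end ErrorBound

section Independence

variable {Ω β γ : Type*} [MeasurableSpace Ω] [MeasurableSpace β] [MeasurableSpace γ]
  {P : Measure Ω} [IsProbabilityMeasure P]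

lemma measureReal_prodMk_mem_eq_integral_of_indepFun {B : Ω → β} {D : Ω → γ} (hB : Measurable B)
    (hD : Measurable D) (hBD : IndepFun B D P) {S : Set (β × γ)} (hS : MeasurableSet S) :
    P.real {ω | (B ω, D ω) ∈ S} = ∫ ω, P.real {ω' | (B ω, D ω') ∈ S} ∂P := by
  have hslice (ω : Ω) : P {ω' | (B ω, D ω') ∈ S} = P.map D (Prod.mk (B ω) ⁻¹' S) :=
    (Measure.map_apply hD (measurable_prodMk_left hS)).symm
  have hfubini : P {ω | (B ω, D ω) ∈ S} = ∫⁻ ω, P.map D (Prod.mk (B ω) ⁻¹' S) ∂P := by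
    have := Measure.isProbabilityMeasure_map (μ := P) hD.aemeasurable
    rw [← lintegral_map (measurable_measure_prodMk_left hS) hB, ← Measure.prod_apply hS,
      ← hBD.map_prod_eq_prod_map_map hB.aemeasurable hD.aemeasurable,
      Measure.map_apply (hB.prodMk hD) hS]
    rfl
  simp only [measureReal_def, hfubini, hslice]
  refine (integral_toReal ((measurable_measure_prodMk_left hS).comp hB).aemeasurable
    (Filter.Eventually.of_forall fun ω => ?_)).symm
  simp only [Function.comp_apply, ← hslice]
  exact measure_lt_top _ _

end Independence

section SingleTask

variable {N : ℕ}

/-- The state and the opinions on a task in which the state is `y` and the sign `x i` tells whether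
expert `i` is right. -/
def taskOutcome (y : ℤˣ) (x : Fin N → ℤˣ) : ℤ × (Fin N → ℤ) := (y, fun i => y * x i)

lemma coe_units_mem (u : ℤˣ) : (u : ℤ) = -1 ∨ (u : ℤ) = 1 := by
  rcases Int.units_eq_one_or u with rfl | rfl <;> simp

lemma exists_units_coe_eq {z : ℤ} (hz : z = -1 ∨ z = 1) : ∃ u : ℤˣ, (u : ℤ) = z :=
  hz.elim (fun h => ⟨-1, by simp [h]⟩) fun h => ⟨1, by simp [h]⟩

lemma taskOutcome_injective :
    Function.Injective fun z : ℤˣ × (Fin N → ℤˣ) => taskOutcome z.1 z.2 := by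
  rintro ⟨y, x⟩ ⟨y', x'⟩ h
  obtain ⟨hy, hx⟩ := Prod.ext_iff.1 h
  obtain rfl : y = y' := Units.ext hy
  refine Prod.ext rfl (funext fun i => mul_left_cancel (a := y) (Units.ext ?_))
  simpa only [taskOutcome, Units.val_mul] using congrFun hx i

lemma exists_taskOutcome_eq {y : ℤ} (hy : y = -1 ∨ y = 1) {x : Fin N → ℤ}
    (hx : ∀ i, x i = -1 ∨ x i = 1) : ∃ v z, taskOutcome v z = (y, x) := by
  obtain ⟨v, rfl⟩ := exists_units_coe_eq hy
  choose u hu using fun i => exists_units_coe_eq (hx i)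
  refine ⟨v, fun i => v * u i, Prod.ext rfl (funext fun i => ?_)⟩
  simp only [taskOutcome, ← hu, ← Units.val_mul, ← mul_assoc, Int.units_mul_self, one_mul]

/-- The fraction of the two states for which the state and the opinions are in `A`, if the sign
`x i` tells whether expert `i` is right. -/
noncomputable def outcomeFraction (A : Set (ℤ × (Fin N → ℤ))) (x : Fin N → ℤˣ) : ℝ :=
  (A.indicator 1 (taskOutcome 1 x) + A.indicator 1 (taskOutcome (-1) x)) / 2

variable {Ω : Type*} [MeasurableSpace Ω] {P : Measure Ω} {T : ℕ} {p : Fin N → ℝ}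
  {Y : ℕ → Ω → ℤ} {X U : Fin N → ℕ → Ω → ℤ} {C : ℕ → Ω → ℤ} {t : ℕ}

namespace IsExpertModel

lemma measurableSet_state (hM : IsExpertModel P T p Y X U C) (ht : t ∈ Finset.Icc 1 T) (y : ℤ) :
    MeasurableSet {ω | Y t ω = y} :=
  hM.measurable_state t ht (measurableSet_singleton y)

lemma measureReal_state (hM : IsExpertModel P T p Y X U C) (ht : t ∈ Finset.Icc 1 T) (y : ℤˣ) :
    P.real {ω | Y t ω = y} = 1 / 2 := by
  rcases Int.units_eq_one_or y with rfl | rfl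
  · exact (hM.uniform_prior t ht).1
  · exact (hM.uniform_prior t ht).2

lemma measurable_outcome (hM : IsExpertModel P T p Y X U C) (ht : t ∈ Finset.Icc 1 T) :
    Measurable fun ω => (Y t ω, fun i => X i t ω) :=
  (hM.measurable_state t ht).prodMk (measurable_pi_lambda _ fun i => hM.measurable_opinion i t ht)

variable [IsProbabilityMeasure P]

lemma isProbabilityMeasure_cond (hM : IsExpertModel P T p Y X U C) (ht : t ∈ Finset.Icc 1 T)
    (y : ℤˣ) : IsProbabilityMeasure (P[|{ω | Y t ω = y}]) := by
  refine cond_isProbabilityMeasure fun h => ?_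
  have := hM.measureReal_state ht y
  rw [measureReal_def, h] at this
  norm_num at this

lemma abs_competence_sub_le (hM : IsExpertModel P T p Y X U C) (ht : t ∈ Finset.Icc 1 T)
    (i : Fin N) : |p i - 1 / 2| ≤ 1 / 2 := by
  have := hM.isProbabilityMeasure_cond ht 1
  rw [← hM.competence i t ht 1 (Or.inr rfl)]
  exact abs_sub_half_le ⟨measureReal_nonneg, measureReal_le_one⟩

lemma cond_measureReal_opinion (hM : IsExpertModel P T p Y X U C) (ht : t ∈ Finset.Icc 1 T)
    (y u : ℤˣ) (i : Fin N) :
    (P[|{ω | Y t ω = y}]).real {ω | X i t ω = y * u} = 1 / 2 + (p i - 1 / 2) * signVal u := by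
  have := hM.isProbabilityMeasure_cond ht y
  have hright : (P[|{ω | Y t ω = y}]).real {ω | X i t ω = y} = p i := by
    rw [← hM.competence i t ht y (coe_units_mem y), measureReal_def, measureReal_def,
      cond_apply (hM.measurableSet_state ht y), cond_apply (hM.measurableSet_state ht y)]
    congr 3
    ext ω
    exact and_congr_right fun h : Y t ω = y => by simp only [Set.mem_ofPred_eq, h]
  rcases Int.units_eq_one_or u with rfl | rfl
  · simp [hright]
  · have hwrong : {ω | X i t ω = y * ((-1 : ℤˣ) : ℤ)} = {ω | X i t ω = y}ᶜ := by
      ext ω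
      have hX := hM.opinion_mem i t ht ω
      have hy := coe_units_mem y
      simp only [Set.mem_ofPred_eq, Set.mem_compl_iff, Units.val_neg, Units.val_one]
      omega
    have hmeas : MeasurableSet {ω | X i t ω = y} :=
      hM.measurable_opinion i t ht (measurableSet_singleton _)
    rw [hwrong, probReal_compl_eq_one_sub hmeas, hright, signVal_neg, signVal_one]
    ring

lemma measureReal_taskOutcome (hM : IsExpertModel P T p Y X U C) (ht : t ∈ Finset.Icc 1 T)
    (y : ℤˣ) (x : Fin N → ℤˣ) :
    P.real {ω | (Y t ω, fun i => X i t ω) = taskOutcome y x}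
      = 1 / 2 * signMass (fun i => p i - 1 / 2) x := by
  have hevent : {ω | (Y t ω, fun i => X i t ω) = taskOutcome y x}
      = {ω | Y t ω = y} ∩ ⋂ i ∈ Finset.univ, X i t ⁻¹' {(y : ℤ) * x i} := by
    ext ω
    simp [taskOutcome, funext_iff]
  have hopinions := (hM.opinions_condIndep t ht y (coe_units_mem y)).measure_inter_preimage_eq_mul
    Finset.univ (sets := fun i => {(y : ℤ) * x i}) fun i _ => measurableSet_singleton _
  rw [hevent, measureReal_def, ← cond_mul_eq_inter (hM.measurableSet_state ht y), hopinions,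
    ENNReal.toReal_mul, ENNReal.toReal_prod, ← measureReal_def, hM.measureReal_state ht, mul_comm]
  exact congrArg _ (Finset.prod_congr rfl fun i _ => hM.cond_measureReal_opinion ht y (x i) i)

lemma measureReal_outcome_mem (hM : IsExpertModel P T p Y X U C) (ht : t ∈ Finset.Icc 1 T)
    (A : Set (ℤ × (Fin N → ℤ))) :
    P.real {ω | (Y t ω, fun i => X i t ω) ∈ A}
      = signMean (fun i => p i - 1 / 2) (outcomeFraction A) := by
  classical
  have hpartition : {ω | (Y t ω, fun i => X i t ω) ∈ A}
      = ⋃ z ∈ Finset.univ.filter fun z : ℤˣ × (Fin N → ℤˣ) => taskOutcome z.1 z.2 ∈ A,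
        {ω | (Y t ω, fun i => X i t ω) = taskOutcome z.1 z.2} := by
    ext ω
    obtain ⟨y, x, h⟩ := exists_taskOutcome_eq (hM.state_mem t ht ω)
      fun i => hM.opinion_mem i t ht ω
    simp only [Set.mem_ofPred_eq, Set.mem_iUnion, Finset.mem_filter_univ, exists_prop]
    exact ⟨fun hA => ⟨(y, x), by rwa [h], h.symm⟩, fun ⟨_, hA, hz⟩ => hz ▸ hA⟩
  have hdisjoint : Pairwise (Function.onFun Disjoint fun z : ℤˣ × (Fin N → ℤˣ) =>
      {ω | (Y t ω, fun i => X i t ω) = taskOutcome z.1 z.2}) := fun _ _ hne =>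
    Set.disjoint_left.2 fun ω h h' => hne (taskOutcome_injective (h.symm.trans h'))
  have hmeas (z : ℤˣ × (Fin N → ℤˣ)) :
      MeasurableSet {ω | (Y t ω, fun i => X i t ω) = taskOutcome z.1 z.2} :=
    hM.measurable_outcome ht (measurableSet_singleton _)
  rw [hpartition, measureReal_biUnion_finset (hdisjoint.set_pairwise _) fun _ _ => hmeas _,
    Finset.sum_filter, Fintype.sum_prod_type_right, signMean]
  refine Finset.sum_congr rfl fun x _ => ?_
  rw [UnitsInt.univ, Finset.sum_pair (by decide), outcomeFraction]
  simp only [hM.measureReal_taskOutcome ht, Set.indicator_apply, Pi.one_apply]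
  split_ifs <;> ring

end IsExpertModel

end SingleTask

section TaskEvents

variable {N : ℕ}

/-- The values of the state and the opinions of a task, and those of the tie of the rule and of the
ties of the peer votes. -/
abbrev TaskData (N : ℕ) : Type := (ℤ × (Fin N → ℤ)) × (ℤ × (Fin N → ℤ))

/-- The random data of task `t`. -/
def taskData {Ω : Type*} (Y : ℕ → Ω → ℤ) (X U : Fin N → ℕ → Ω → ℤ) (C : ℕ → Ω → ℤ) (t : ℕ)
    (ω : Ω) : TaskData N :=
  ((Y t ω, fun i => X i t ω), (C t ω, fun i => U i t ω))

lemma outcomeFraction_weightedVote_ne (w : Fin N → EReal) (x : Fin N → ℤˣ) {c : ℤ}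
    (hc : c = -1 ∨ c = 1) :
    outcomeFraction {d | weightedVote w d.2 c ≠ d.1} x = voteErr w x := by
  have hvote (x : Fin N → ℤˣ) : weightedVote w (fun i => (x i : ℤ)) c
      = if supportWeight w (-x) < supportWeight w x then 1
        else if supportWeight w x < supportWeight w (-x) then -1 else c := by
    simp only [weightedVote, supportWeight, Pi.neg_apply, signVal_neg, EReal.coe_neg,
      EReal.neg_mul]
    rfl
  have hright : weightedVote w (taskOutcome 1 x).2 c = weightedVote w (fun i => (x i : ℤ)) c := by
    simp [taskOutcome]
  have hwrong : weightedVote w (taskOutcome (-1) x).2 c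
      = weightedVote w (fun i => ((-x) i : ℤ)) c := by
    simp [taskOutcome]
  simp only [outcomeFraction, Set.indicator_apply, Set.mem_ofPred_eq, hright, hwrong, hvote,
    neg_neg, voteErr]
  rcases lt_trichotomy (supportWeight w (-x)) (supportWeight w x) with h | h | h
  · simp [taskOutcome, h, h.not_gt]
  · rcases hc with rfl | rfl <;> simp [taskOutcome, h]
  · simp [taskOutcome, h, h.not_gt]

lemma outcomeFraction_eq_peerVote (i : Fin N) (x : Fin N → ℤˣ) {u : ℤ} (hu : u = -1 ∨ u = 1) :
    outcomeFraction {d | d.2 i = peerVote d.2 i u} x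
      = 1 / 2 + 1 / 2 * (signVal (x i) * peerSign i x) := by
  have hright : peerVote (taskOutcome 1 x).2 i u = signTie (peerSum i x) u := by
    simp [taskOutcome, peerVote, peerSum]
  have hwrong : peerVote (taskOutcome (-1) x).2 i u = signTie (-peerSum i x) u := by
    simp [taskOutcome, peerVote, peerSum]
  simp only [outcomeFraction, Set.indicator_apply, Set.mem_ofPred_eq, hright, hwrong, peerSign,
    signTie, Left.neg_pos_iff, Left.neg_neg_iff]
  rcases lt_trichotomy (peerSum i x) 0 with h | h | h <;>
    rcases Int.units_eq_one_or (x i) with hx | hx <;>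
    rcases hu with rfl | rfl <;> simp [taskOutcome, h, h.not_gt, hx] <;> norm_num

variable {Ω : Type*} [MeasurableSpace Ω] {P : Measure Ω} {T : ℕ} {p : Fin N → ℝ}
  {Y : ℕ → Ω → ℤ} {X U : Fin N → ℕ → Ω → ℤ} {C : ℕ → Ω → ℤ} {t : ℕ}

namespace IsExpertModel

lemma measurable_ties (hM : IsExpertModel P T p Y X U C) (ht : t ∈ Finset.Icc 1 T) :
    Measurable fun ω => (C t ω, fun i => U i t ω) :=
  (hM.measurable_ruleTie t ht).prodMk (measurable_pi_lambda _ fun i => hM.measurable_voteTie i t ht)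

lemma measurable_taskData (hM : IsExpertModel P T p Y X U C) (ht : t ∈ Finset.Icc 1 T) :
    Measurable (taskData Y X U C t) :=
  (hM.measurable_outcome ht).prodMk (hM.measurable_ties ht)

variable [IsProbabilityMeasure P]

lemma measureReal_taskData_mem (hM : IsExpertModel P T p Y X U C) (ht : t ∈ Finset.Icc 1 T)
    {S : Set (TaskData N)} {F : (Fin N → ℤˣ) → ℝ}
    (hF : ∀ ω x, outcomeFraction {d | (d, (C t ω, fun i => U i t ω)) ∈ S} x = F x) :
    P.real {ω | taskData Y X U C t ω ∈ S} = signMean (fun i => p i - 1 / 2) F := by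
  have hfubini := measureReal_prodMk_mem_eq_integral_of_indepFun (hM.measurable_ties ht)
    (hM.measurable_outcome ht) (hM.ties_indep t ht).symm (S := Prod.swap ⁻¹' S) .of_discrete
  have hslice (ω : Ω) : P.real {ω' | ((C t ω, fun i => U i t ω), (Y t ω', fun i => X i t ω'))
      ∈ Prod.swap ⁻¹' S} = signMean (fun i => p i - 1 / 2) F := by
    rw [← funext (hF ω), ← hM.measureReal_outcome_mem ht]
    rfl
  simp only [hslice, integral_const, probReal_univ, one_smul] at hfubini
  exact hfubini

lemma measureReal_weightedVote_ne (hM : IsExpertModel P T p Y X U C) (ht : t ∈ Finset.Icc 1 T)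
    (w : Fin N → EReal) :
    P.real {ω | weightedVote w (fun i => X i t ω) (C t ω) ≠ Y t ω}
      = signMean (fun i => p i - 1 / 2) (voteErr w) :=
  hM.measureReal_taskData_mem ht (S := {d | weightedVote w d.1.2 d.2.1 ≠ d.1.1})
    fun ω x => outcomeFraction_weightedVote_ne w x (hM.ruleTie_mem t ht ω)

lemma pseudoCompetence_eq (hM : IsExpertModel P T p Y X U C) (ht : t ∈ Finset.Icc 1 T)
    (i : Fin N) :
    pseudoCompetence P X U i t
      = 1 / 2 + 2 * (p i - 1 / 2) * peerBias (fun i => p i - 1 / 2) i := by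
  have hmean := hM.measureReal_taskData_mem ht (S := {d | d.1.2 i = peerVote d.1.2 i (d.2.2 i)})
    fun ω x => outcomeFraction_eq_peerVote i x (hM.voteTie_mem i t ht ω)
  rw [signMean_add, signMean_const, signMean_const_mul,
    signMean_signVal_mul fun x => peerSign_flipAt i x] at hmean
  rw [peerBias]
  exact hmean.trans (by ring)

lemma abs_sub_pseudoCompetence (hM : IsExpertModel P T p Y X U C) (ht : t ∈ Finset.Icc 1 T)
    (i : Fin N) :
    |p i - pseudoCompetence P X U i t| = competenceDefect (fun i => p i - 1 / 2) i := by
  have hbias := (abs_le.1 (abs_peerBias_le (hM.abs_competence_sub_le ht) i)).2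
  rw [hM.pseudoCompetence_eq ht, competenceDefect,
    ← abs_of_nonneg (by linarith : 0 ≤ 1 - 2 * peerBias (fun i => p i - 1 / 2) i), ← abs_mul]
  congr 1
  ring

end IsExpertModel

end TaskEvents

section Concentration

variable {Ω : Type*} [MeasurableSpace Ω] {P : Measure Ω} {κ : Type*} {s : Finset κ}
  {Z : κ → Ω → ℝ}

lemma integral_average {c : ℝ} (hs : s.Nonempty) (hZ : ∀ k ∈ s, Integrable (Z k) P)
    (hc : ∀ k ∈ s, ∫ ω, Z k ω ∂P = c) : ∫ ω, (∑ k ∈ s, Z k ω) / s.card ∂P = c := by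
  have hcard : (s.card : ℝ) ≠ 0 := Nat.cast_ne_zero.2 hs.card_pos.ne'
  rw [integral_div, integral_finsetSum _ hZ, Finset.sum_congr rfl hc, Finset.sum_const,
    nsmul_eq_mul, mul_div_cancel_left₀ _ hcard]

variable [IsProbabilityMeasure P]

lemma integral_abs_sub_integral_le_sqrt_variance {f : Ω → ℝ} (hf : MemLp f 2 P) :
    ∫ ω, |f ω - ∫ ω', f ω' ∂P| ∂P ≤ √(variance f P) := by
  have habs := variance_nonneg (fun ω => |f ω - ∫ ω', f ω' ∂P|) P
  have hLp : MemLp (fun ω => |f ω - ∫ ω', f ω' ∂P|) 2 P := (hf.sub (memLp_const _)).abs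
  rw [variance_eq_sub hLp] at habs
  simp only [Pi.pow_apply, sq_abs, sub_nonneg] at habs
  refine Real.le_sqrt_of_sq_le (habs.trans_eq ?_)
  rw [variance_eq_integral hf.aestronglyMeasurable.aemeasurable]

lemma memLp_of_mem_Icc_zero_one {f : Ω → ℝ} (hf : AEMeasurable f P)
    (h : ∀ᵐ ω ∂P, f ω ∈ Set.Icc 0 1) : MemLp f 2 P :=
  MemLp.of_bound hf.aestronglyMeasurable 1 (h.mono fun ω hω => by
    rw [Real.norm_eq_abs, abs_of_nonneg hω.1]
    exact hω.2)

lemma variance_average_le (hZ : ∀ k ∈ s, AEMeasurable (Z k) P)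
    (hZ₀₁ : ∀ k ∈ s, ∀ᵐ ω ∂P, Z k ω ∈ Set.Icc 0 1)
    (hind : Set.Pairwise (s : Set κ) fun k l => IndepFun (Z k) (Z l) P) :
    variance (fun ω => (∑ k ∈ s, Z k ω) / s.card) P ≤ 1 / (4 * s.card) := by
  have hsum : variance (∑ k ∈ s, Z k) P ≤ s.card / 4 := by
    rw [IndepFun.variance_sum (fun k hk => memLp_of_mem_Icc_zero_one (hZ k hk) (hZ₀₁ k hk)) hind]
    refine (Finset.sum_le_card_nsmul s _ _ fun k hk =>
      variance_le_sq_of_bounded (hZ₀₁ k hk) (hZ k hk)).trans_eq ?_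
    rw [nsmul_eq_mul]
    ring
  have hscale : variance (fun ω => (∑ k ∈ s, Z k ω) / s.card) P
      = (s.card : ℝ)⁻¹ ^ 2 * variance (∑ k ∈ s, Z k) P := by
    simp only [div_eq_inv_mul, variance_const_mul, ← Finset.sum_fn]
  rw [hscale]
  refine (mul_le_mul_of_nonneg_left hsum (by positivity)).trans_eq ?_
  rcases eq_or_ne (s.card : ℝ) 0 with h | h
  · simp [h]
  · field_simp

lemma integral_abs_average_sub_le {c : ℝ} (hs : s.Nonempty) (hZ : ∀ k ∈ s, AEMeasurable (Z k) P)
    (hZ₀₁ : ∀ k ∈ s, ∀ᵐ ω ∂P, Z k ω ∈ Set.Icc 0 1)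
    (hind : Set.Pairwise (s : Set κ) fun k l => IndepFun (Z k) (Z l) P)
    (hc : ∀ k ∈ s, ∫ ω, Z k ω ∂P = c) :
    ∫ ω, |(∑ k ∈ s, Z k ω) / s.card - c| ∂P ≤ 1 / (2 * √s.card) := by
  have hLp (k : κ) (hk : k ∈ s) : MemLp (Z k) 2 P := memLp_of_mem_Icc_zero_one (hZ k hk) (hZ₀₁ k hk)
  have hLp_average : MemLp (fun ω => (∑ k ∈ s, Z k ω) / s.card) 2 P := by
    simp only [div_eq_inv_mul]
    exact (memLp_finsetSum _ hLp).const_mul _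
  have habs := integral_abs_sub_integral_le_sqrt_variance hLp_average
  rw [integral_average hs (fun k hk => (hLp k hk).integrable one_le_two) hc] at habs
  refine habs.trans ((Real.sqrt_le_sqrt (variance_average_le hZ hZ₀₁ hind)).trans_eq ?_)
  rw [Real.sqrt_div zero_le_one, Real.sqrt_one, Real.sqrt_mul (by norm_num),
    show (4 : ℝ) = 2 ^ 2 by norm_num, Real.sqrt_sq (by norm_num)]

end Concentration

section DeviationCost

variable {Ω : Type*} [MeasurableSpace Ω] {P : Measure Ω} {r : Ω → ℝ} {a : ℝ}

lemma deviationCost_eq (a r : ℝ) :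
    deviationCost a r = 3 / 2 * |r| - (if 0 ≤ a then 1 / 2 else -1 / 2) * r := by
  unfold deviationCost
  split_ifs <;> ring

lemma integrable_deviationCost (hr : Integrable r P) :
    Integrable (fun ω => deviationCost a (r ω)) P := by
  simp only [deviationCost_eq]
  exact (hr.abs.const_mul _).sub (hr.const_mul _)

lemma integral_deviationCost (hr : Integrable r P) (hmean : ∫ ω, r ω ∂P = 0) :
    ∫ ω, deviationCost a (r ω) ∂P = 3 / 2 * ∫ ω, |r ω| ∂P := by
  simp only [deviationCost_eq]
  rw [integral_sub (hr.abs.const_mul _) (hr.const_mul _), integral_const_mul, integral_const_mul,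
    hmean, mul_zero, sub_zero]

end DeviationCost

section AdaptiveRule

variable {N : ℕ}

/-- The indicator of the agreement of expert `i` with the majority vote of its peers. -/
noncomputable def agreement (i : Fin N) (d : TaskData N) : ℝ :=
  if d.1.2 i = peerVote d.1.2 i (d.2.2 i) then 1 else 0

lemma agreement_mem_Icc (i : Fin N) (d : TaskData N) : agreement i d ∈ Set.Icc 0 1 := by
  unfold agreement
  split_ifs <;> norm_num

/-- The fraction of the tasks `1, …, τ` with data `d` on which expert `i` agrees with the majority
vote of its peers. -/
noncomputable def agreementRate {τ : ℕ} (d : Finset.Icc 1 τ → TaskData N) (i : Fin N) : ℝ :=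
  (∑ s, agreement i (d s)) / τ

/-- The data of the tasks `1, …, τ`, on which the weights of the adaptive rule depend. -/
def pastData {Ω : Type*} (Y : ℕ → Ω → ℤ) (X U : Fin N → ℕ → Ω → ℤ) (C : ℕ → Ω → ℤ) (τ : ℕ)
    (ω : Ω) (s : Finset.Icc 1 τ) : TaskData N :=
  taskData Y X U C s ω

lemma coe_ereal_sum {κ : Type*} (s : Finset κ) (f : κ → ℝ) :
    ((∑ k ∈ s, f k : ℝ) : EReal) = ∑ k ∈ s, (f k : EReal) :=
  map_sum (⟨⟨Real.toEReal, EReal.coe_zero⟩, EReal.coe_add⟩ : ℝ →+ EReal) f s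

lemma committeePotential_eq_coe {q : Fin N → ℝ} (hq : ∀ i, q i ∈ Set.Ioo 0 1) :
    committeePotential q = ((∑ i, (q i - 1 / 2) * logit (q i - 1 / 2) : ℝ) : EReal) := by
  rw [coe_ereal_sum]
  refine Finset.sum_congr rfl fun i _ => ?_
  rw [naiveBayesWeight_eq_logit (hq i).1 (hq i).2, EReal.coe_mul]

variable {Ω : Type*} {Y : ℕ → Ω → ℤ} {X U : Fin N → ℕ → Ω → ℤ} {C : ℕ → Ω → ℤ} {τ t T : ℕ} {δ : ℝ}

lemma agreementRate_pastData (ω : Ω) (i : Fin N) :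
    agreementRate (pastData Y X U C τ ω) i = empiricalPseudoCompetence X U τ ω i :=
  congrArg (· / (τ : ℝ)) (Finset.sum_coe_sort (Finset.Icc 1 τ) fun s =>
    agreement i (taskData Y X U C s ω))

lemma exp_le_of_mem_confidenceEvent {ω : Ω} (hω : ω ∈ confidenceEvent X U τ δ)
    (hq : ∀ i, empiricalPseudoCompetence X U τ ω i ∈ Set.Ioo 0 1) :
    Real.exp (-(∑ i, (empiricalPseudoCompetence X U τ ω i - 1 / 2)
      * logit (empiricalPseudoCompetence X U τ ω i - 1 / 2)) / 2) ≤ δ / 2 := by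
  rw [confidenceEvent, Set.mem_ofPred_eq, committeePotential_eq_coe hq, ← EReal.coe_mul,
    EReal.exp_coe, ENNReal.ofReal_le_ofReal_iff', neg_mul, one_div_mul_eq_div, ← neg_div] at hω
  exact hω.resolve_right (not_le.2 (Real.exp_pos _))

lemma empiricalPseudoCompetence_mem_Icc (ω : Ω) (i : Fin N) :
    empiricalPseudoCompetence X U τ ω i ∈ Set.Icc 0 1 := by
  rw [← agreementRate_pastData (Y := fun _ _ => 0) (C := fun _ _ => 0)]
  refine ⟨div_nonneg (Finset.sum_nonneg fun s _ => (agreement_mem_Icc i _).1) τ.cast_nonneg,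
    div_le_one_of_le₀ ?_ τ.cast_nonneg⟩
  refine (Finset.sum_le_card_nsmul _ _ 1 fun s _ => (agreement_mem_Icc i _).2).trans_eq ?_
  simp

/-- Two experts are each other's only peer. -/
lemma empiricalPseudoCompetence_congr (hN : N = 2) {ω : Ω}
    (hX : ∀ i, ∀ s ∈ Finset.Icc 1 τ, X i s ω = -1 ∨ X i s ω = 1) (i j : Fin N) :
    empiricalPseudoCompetence X U τ ω i = empiricalPseudoCompetence X U τ ω j := by
  subst hN
  have hsign {x : ℤ} (hx : x = -1 ∨ x = 1) (tie : ℤ) : signTie x tie = x := by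
    rcases hx with rfl | rfl <;> simp [signTie]
  have hpeer (k l : Fin 2) (hkl : k ≠ l) (s : ℕ) (hs : s ∈ Finset.Icc 1 τ) :
      peerVote (fun j => X j s ω) k (U k s ω) = X l s ω := by
    have herase : Finset.univ.erase k = {l} := by grind
    rw [peerVote, herase, Finset.sum_singleton, hsign (hX l s hs)]
  rcases eq_or_ne i j with rfl | hij
  · rfl
  unfold empiricalPseudoCompetence
  congr 1
  refine Finset.sum_congr rfl fun s hs => ?_
  rw [hpeer i j hij s hs, hpeer j i hij.symm s hs]
  simp only [eq_comm]

variable [MeasurableSpace Ω] {P : Measure Ω} {p : Fin N → ℝ}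

namespace IsExpertModel

lemma indepFun_taskData (hM : IsExpertModel P T p Y X U C) {s : ℕ} (hs : s ∈ Finset.Icc 1 T)
    (ht : t ∈ Finset.Icc 1 T) (hst : s ≠ t) :
    IndepFun (taskData Y X U C s) (taskData Y X U C t) P :=
  hM.tasks_indep.indepFun (i := ⟨s, hs⟩) (j := ⟨t, ht⟩) (Subtype.coe_ne_coe.1 hst)

lemma measurable_agreement (hM : IsExpertModel P T p Y X U C) (ht : t ∈ Finset.Icc 1 T)
    (i : Fin N) : Measurable fun ω => agreement i (taskData Y X U C t ω) :=
  (Measurable.of_discrete (f := agreement i)).comp (hM.measurable_taskData ht)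

lemma measurable_empiricalPseudoCompetence (hM : IsExpertModel P T p Y X U C) (hτT : τ ≤ T)
    (i : Fin N) : Measurable fun ω => empiricalPseudoCompetence X U τ ω i :=
  (Finset.measurable_fun_sum _ fun _ hs =>
    hM.measurable_agreement (Finset.Icc_subset_Icc_right hτT hs) i).div_const _

lemma measurable_pastData (hM : IsExpertModel P T p Y X U C) (hτT : τ ≤ T) :
    Measurable (pastData Y X U C τ) :=
  measurable_pi_lambda _ fun s =>
    hM.measurable_taskData (Finset.Icc_subset_Icc_right hτT s.2)

lemma indepFun_pastData (hM : IsExpertModel P T p Y X U C) (hτt : τ < t) (htT : t ≤ T) :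
    IndepFun (pastData Y X U C τ) (taskData Y X U C t) P := by
  have ht : t ∈ Finset.Icc 1 T := Finset.mem_Icc.2 ⟨by omega, htT⟩
  have hmem (s : Finset.Icc 1 τ) : s.1 ∈ Finset.Icc 1 T :=
    Finset.Icc_subset_Icc_right (hτt.le.trans htT) s.2
  set past : Finset (Finset.Icc 1 T) := Finset.univ.filter fun s => s.1 ≤ τ with hpast
  have hmem_past (s : Finset.Icc 1 τ) : (⟨s.1, hmem s⟩ : Finset.Icc 1 T) ∈ past := by
    simp [hpast, (Finset.mem_Icc.1 s.2).2]
  have hdisjoint : Disjoint past {⟨t, ht⟩} := by simp [hpast, hτt]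
  exact (hM.tasks_indep.indepFun_finset past {⟨t, ht⟩} hdisjoint
    fun s => hM.measurable_taskData s.2).comp
    (φ := fun d (s : Finset.Icc 1 τ) => d ⟨⟨s.1, hmem s⟩, hmem_past s⟩)
    (ψ := fun d => d ⟨⟨t, ht⟩, Finset.mem_singleton_self _⟩)
    (measurable_pi_lambda _ fun s => measurable_pi_apply _) .of_discrete

variable [IsProbabilityMeasure P]

lemma measureReal_confidenceEvent_inter_eq_integral (hM : IsExpertModel P T p Y X U C)
    (hτt : τ < t) (htT : t ≤ T) :
    P.real (confidenceEvent X U τ δ ∩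
        {ω | adaptiveRule X U τ ω (fun i => X i t ω) (C t ω) ≠ Y t ω})
      = ∫ ω, P.real {ω' | ω ∈ confidenceEvent X U τ δ ∧
          adaptiveRule X U τ ω (fun i => X i t ω') (C t ω') ≠ Y t ω'} ∂P := by
  have hfubini := measureReal_prodMk_mem_eq_integral_of_indepFun
    (hM.measurable_pastData (hτt.le.trans htT))
    (hM.measurable_taskData (Finset.mem_Icc.2 ⟨by omega, htT⟩)) (hM.indepFun_pastData hτt htT)
    (S := {z | EReal.exp (((-(1 / 2) : ℝ) : EReal) * committeePotential (agreementRate z.1))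
        ≤ ENNReal.ofReal (δ / 2) ∧
      weightedVote (fun i => naiveBayesWeight (agreementRate z.1 i)) z.2.1.2 z.2.2.1 ≠ z.2.1.1})
    .of_discrete
  simp only [Set.mem_ofPred_eq, funext (agreementRate_pastData _)] at hfubini
  exact hfubini

lemma measureReal_adaptiveRule_ne_le (hM : IsExpertModel P T p Y X U C) (hτT : τ ≤ T)
    (ht : t ∈ Finset.Icc 1 T) (hδ : δ ≤ 1)
    (hdefect : ∑ i, competenceDefect (fun i => p i - 1 / 2) i ≤ δ) {ω : Ω}
    (hω : ω ∈ confidenceEvent X U τ δ) :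
    P.real {ω' | adaptiveRule X U τ ω (fun i => X i t ω') (C t ω') ≠ Y t ω'}
      ≤ δ / 4 + 3 / 4 * ∑ i, competenceDefect (fun i => p i - 1 / 2) i
        + ∑ i, voterDeviationCost (fun i => p i - 1 / 2) (empiricalPseudoCompetence X U τ ω) i :=
  (hM.measureReal_weightedVote_ne ht _).trans_le
    (signMean_naiveBayesErr_le (hM.abs_competence_sub_le ht) (empiricalPseudoCompetence_mem_Icc ω)
      (fun hN => empiricalPseudoCompetence_congr (by simpa using hN) fun i s hs =>
        hM.opinion_mem i s (Finset.Icc_subset_Icc_right hτT hs) ω)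
      hδ hdefect (exp_le_of_mem_confidenceEvent hω))

lemma integral_agreement (hM : IsExpertModel P T p Y X U C) {s : ℕ} (hs : s ∈ Finset.Icc 1 T)
    (ht : t ∈ Finset.Icc 1 T) (i : Fin N) :
    ∫ ω, agreement i (taskData Y X U C s ω) ∂P = pseudoCompetence P X U i t := by
  have hmeas : MeasurableSet {ω | X i s ω = peerVote (fun j => X j s ω) i (U i s ω)} :=
    hM.measurable_taskData hs (MeasurableSet.of_discrete
      (s := {d : TaskData N | d.1.2 i = peerVote d.1.2 i (d.2.2 i)}))
  rw [hM.pseudoCompetence_eq ht, ← hM.pseudoCompetence_eq hs, pseudoCompetence,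
    ← integral_indicator_one hmeas]
  refine integral_congr_ae (.of_forall fun ω => ?_)
  simp only [agreement, taskData, Set.indicator_apply, Set.mem_ofPred_eq, Pi.one_apply]
  congr

lemma integral_empiricalPseudoCompetence (hM : IsExpertModel P T p Y X U C) (hτ : 1 ≤ τ)
    (hτT : τ ≤ T) (ht : t ∈ Finset.Icc 1 T) (i : Fin N) :
    ∫ ω, empiricalPseudoCompetence X U τ ω i ∂P = pseudoCompetence P X U i t := by
  have hmem {s : ℕ} (hs : s ∈ Finset.Icc 1 τ) := Finset.Icc_subset_Icc_right hτT hs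
  have hmean := integral_average (P := P) (Finset.nonempty_Icc.2 hτ)
    (fun s hs => (memLp_of_mem_Icc_zero_one (hM.measurable_agreement (hmem hs) i).aemeasurable
      (.of_forall fun _ => agreement_mem_Icc i _)).integrable one_le_two)
    (fun s hs => hM.integral_agreement (hmem hs) ht i)
  rwa [Nat.card_Icc, Nat.add_sub_cancel] at hmean

lemma integral_abs_empiricalPseudoCompetence_sub_le (hM : IsExpertModel P T p Y X U C)
    (hτ : 1 ≤ τ) (hτT : τ ≤ T) (ht : t ∈ Finset.Icc 1 T) (i : Fin N) :
    ∫ ω, |empiricalPseudoCompetence X U τ ω i - pseudoCompetence P X U i t| ∂P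
      ≤ 1 / (2 * √τ) := by
  have hmem {s : ℕ} (hs : s ∈ Finset.Icc 1 τ) := Finset.Icc_subset_Icc_right hτT hs
  have habs := integral_abs_average_sub_le (P := P) (Finset.nonempty_Icc.2 hτ)
    (fun s hs => (hM.measurable_agreement (hmem hs) i).aemeasurable)
    (fun s _ => .of_forall fun _ => agreement_mem_Icc i _)
    (fun k hk l hl hkl => (hM.indepFun_taskData (hmem hk) (hmem hl) hkl).comp
      (φ := agreement i) (ψ := agreement i) .of_discrete .of_discrete)
    (fun s hs => hM.integral_agreement (hmem hs) ht i)
  rwa [Nat.card_Icc, Nat.add_sub_cancel] at habs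

lemma integrable_empiricalPseudoCompetence (hM : IsExpertModel P T p Y X U C) (hτT : τ ≤ T)
    (i : Fin N) : Integrable (fun ω => empiricalPseudoCompetence X U τ ω i) P :=
  (memLp_of_mem_Icc_zero_one (hM.measurable_empiricalPseudoCompetence hτT i).aemeasurable
    (.of_forall fun ω => empiricalPseudoCompetence_mem_Icc ω i)).integrable one_le_two

lemma voterDeviationCost_empiricalPseudoCompetence (hM : IsExpertModel P T p Y X U C)
    (ht : t ∈ Finset.Icc 1 T) (ω : Ω) (i : Fin N) :
    voterDeviationCost (fun i => p i - 1 / 2) (empiricalPseudoCompetence X U τ ω) i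
      = deviationCost (p i - 1 / 2)
        (empiricalPseudoCompetence X U τ ω i - pseudoCompetence P X U i t) := by
  rw [hM.pseudoCompetence_eq ht, voterDeviationCost]
  congr 1
  ring

lemma integrable_voterDeviationCost (hM : IsExpertModel P T p Y X U C) (hτT : τ ≤ T)
    (ht : t ∈ Finset.Icc 1 T) (i : Fin N) :
    Integrable (fun ω => voterDeviationCost (fun i => p i - 1 / 2)
      (empiricalPseudoCompetence X U τ ω) i) P := by
  simp only [hM.voterDeviationCost_empiricalPseudoCompetence ht]
  exact integrable_deviationCost
    ((hM.integrable_empiricalPseudoCompetence hτT i).sub (integrable_const _))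

lemma integral_voterDeviationCost_le (hM : IsExpertModel P T p Y X U C) (hτ : 1 ≤ τ)
    (hτT : τ ≤ T) (ht : t ∈ Finset.Icc 1 T) (i : Fin N) :
    ∫ ω, voterDeviationCost (fun i => p i - 1 / 2) (empiricalPseudoCompetence X U τ ω) i ∂P
      ≤ 3 / (4 * √τ) := by
  have hint := hM.integrable_empiricalPseudoCompetence hτT i
  simp only [hM.voterDeviationCost_empiricalPseudoCompetence ht]
  have hmean : ∫ ω, (empiricalPseudoCompetence X U τ ω i - pseudoCompetence P X U i t) ∂P = 0 := by
    rw [integral_sub hint (integrable_const _), hM.integral_empiricalPseudoCompetence hτ hτT ht,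
      integral_const, probReal_univ, one_smul, sub_self]
  rw [integral_deviationCost
    (r := fun ω => empiricalPseudoCompetence X U τ ω i - pseudoCompetence P X U i t)
    (hint.sub (integrable_const _)) hmean]
  calc _ ≤ 3 / 2 * (1 / (2 * √τ)) := mul_le_mul_of_nonneg_left
        (hM.integral_abs_empiricalPseudoCompetence_sub_le hτ hτT ht i) (by norm_num)
    _ = 3 / (4 * √τ) := by ring

lemma measureReal_confident_adaptiveRule_ne_le (hM : IsExpertModel P T p Y X U C) (hτT : τ ≤ T)
    (ht : t ∈ Finset.Icc 1 T) (hδ : δ ≤ 1)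
    (hdefect : ∑ i, competenceDefect (fun i => p i - 1 / 2) i ≤ δ) (ω : Ω) :
    P.real {ω' | ω ∈ confidenceEvent X U τ δ ∧
        adaptiveRule X U τ ω (fun i => X i t ω') (C t ω') ≠ Y t ω'}
      ≤ δ / 4 + 3 / 4 * ∑ i, competenceDefect (fun i => p i - 1 / 2) i
        + ∑ i, voterDeviationCost (fun i => p i - 1 / 2) (empiricalPseudoCompetence X U τ ω) i := by
  by_cases hω : ω ∈ confidenceEvent X U τ δ
  · simp only [hω, true_and]
    exact hM.measureReal_adaptiveRule_ne_le hτT ht hδ hdefect hω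
  · have hdefect₀ := Finset.sum_nonneg fun i (_ : i ∈ Finset.univ) =>
      competenceDefect_nonneg (hM.abs_competence_sub_le ht) i
    have hcost := Finset.sum_nonneg fun i (_ : i ∈ Finset.univ) =>
      voterDeviationCost_nonneg (fun i => p i - 1 / 2) (empiricalPseudoCompetence X U τ ω) i
    simp only [hω, false_and, Set.ofPred_false, measureReal_empty]
    linarith

lemma measureReal_confidenceEvent_inter_le (hM : IsExpertModel P T p Y X U C) (hτ : 1 ≤ τ)
    (hτt : τ < t) (htT : t ≤ T) (hδ : δ ≤ 1)
    (hdefect : ∑ i, competenceDefect (fun i => p i - 1 / 2) i ≤ δ) :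
    P.real (confidenceEvent X U τ δ ∩
        {ω | adaptiveRule X U τ ω (fun i => X i t ω) (C t ω) ≠ Y t ω})
      ≤ δ / 4 + 3 / 4 * ∑ i, competenceDefect (fun i => p i - 1 / 2) i + 3 / 4 * (N / √τ) := by
  have hτT : τ ≤ T := hτt.le.trans htT
  have ht : t ∈ Finset.Icc 1 T := Finset.mem_Icc.2 ⟨by omega, htT⟩
  have hint (i : Fin N) := hM.integrable_voterDeviationCost hτT ht i
  have hint_sum := integrable_finsetSum Finset.univ fun i _ => hint i
  have hcost : ∑ i, ∫ ω, voterDeviationCost (fun i => p i - 1 / 2)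
      (empiricalPseudoCompetence X U τ ω) i ∂P ≤ 3 / 4 * (N / √τ) := by
    refine (Finset.sum_le_card_nsmul _ _ _ fun i _ =>
      hM.integral_voterDeviationCost_le hτ hτT ht i).trans_eq ?_
    rw [Finset.card_univ, Fintype.card_fin, nsmul_eq_mul]
    ring
  rw [hM.measureReal_confidenceEvent_inter_eq_integral hτt htT]
  refine (integral_mono_of_nonneg (.of_forall fun ω => measureReal_nonneg)
    ((integrable_const _).add hint_sum)
    (.of_forall (hM.measureReal_confident_adaptiveRule_ne_le hτT ht hδ hdefect))).trans ?_
  rw [integral_add' (integrable_const _) hint_sum, integral_const, probReal_univ, one_smul,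
    integral_finsetSum _ fun i _ => hint i]
  exact add_le_add_right hcost _

end IsExpertModel

end AdaptiveRule

theorem theorem5 {Ω : Type*} [MeasurableSpace Ω] (P : Measure Ω) [IsProbabilityMeasure P]
    {N T : ℕ} (p : Fin N → ℝ) (Y : ℕ → Ω → ℤ) (X : Fin N → ℕ → Ω → ℤ)
    (U : Fin N → ℕ → Ω → ℤ) (C : ℕ → Ω → ℤ) (hM : IsExpertModel P T p Y X U C)
    (s : ℕ) (hs : s ∈ Finset.Icc 1 T) (τ : ℕ) (hτ : 1 ≤ τ) (δ : ℝ)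
    (hδ : ∑ i, |p i - pseudoCompetence P X U i s| + (N : ℝ) / √(τ : ℝ) ≤ δ) :
    ∀ t : ℕ, τ < t → t ≤ T →
      P.real (confidenceEvent X U τ δ ∩
        {ω | adaptiveRule X U τ ω (fun i => X i t ω) (C t ω) ≠ Y t ω}) ≤ δ := by
  intro t hτt htT
  rcases le_total 1 δ with hδ₁ | hδ₁
  · exact measureReal_le_one.trans hδ₁
  simp only [hM.abs_sub_pseudoCompetence hs] at hδ
  have hdefect : ∑ i, competenceDefect (fun i => p i - 1 / 2) i ≤ δ :=
    (le_add_of_nonneg_right (by positivity)).trans hδ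
  have hbound := hM.measureReal_confidenceEvent_inter_le hτ hτt htT hδ₁ hdefect
  linarith
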